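/- Let $n \ge 1$ and let $(W,S)$ be a Coxeter system of type $B_n$ (so $W$ is finite), with length function $\ell$. For $I \subseteq S$ put $$X_I=\{w\in W \mid \ell(ws)>\ell(w)\ \text{for all } s\in I\},\qquad x_I=\sum_{w\in X_I} w\in\mathbb{Q}W ,$$ and let $\Sigma(W)$ be the $\mathbb{Q}$-linear span of the elements $x_I$, $I\subseteq S$, in the group algebra $\mathbb{Q}W$. Then $\Sigma(W)$ is a unital subalgebra of $\mathbb{Q}W$ (Solomon's descent algebra of $W$), and its Loewy length, that is, the smallest integer $k\ge 1$ such that $(\operatorname{Rad}\Sigma(W))^k=0$, where $\operatorname{Rad}$ denotes the Jacobson radical, is equal to $\lceil n/2\rceil$. -/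

import Mathlib

namespace CoxeterSystem

variable {B W : Type*} [Group W] {M : CoxeterMatrix B}

/-- For a set `I` of simple reflections (given by their indices), the set `X_I` of all `w` with
`w s > w` for every `s ∈ I`, that is `ℓ (w s) > ℓ w`: the distinguished (minimal length)
representatives of the cosets `w W_I`. -/
def distinguishedReps (cs : CoxeterSystem M W) (I : Set B) : Set W :=
  {w | ∀ i ∈ I, cs.length w < cs.length (w * cs.simple i)}

/-- The element `x_I = ∑ w ∈ X_I, w` of the group algebra `ℚ W`
(meaningful when `W` is finite). -/
noncomputable def descentElement (cs : CoxeterSystem M W) (I : Set B) : MonoidAlgebra ℚ W :=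
  ∑ᶠ w ∈ cs.distinguishedReps I, MonoidAlgebra.of ℚ W w

/-- The subspace `Σ(W)` of the group algebra `ℚ W` spanned by the elements `x_I`, where `I` runs
through all sets of simple reflections. -/
noncomputable def descentSpace (cs : CoxeterSystem M W) : Submodule ℚ (MonoidAlgebra ℚ W) :=
  Submodule.span ℚ (Set.range cs.descentElement)

end CoxeterSystem

/-- `k` is the Loewy length of the ring `A`: the smallest natural number `k ≥ 1` such that the
`k`-th power of the (Jacobson) radical of `A` vanishes. -/
def IsLoewyLength (A : Type*) [Ring A] (k : ℕ) : Prop :=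
  IsLeast {m : ℕ | 1 ≤ m ∧ Ring.jacobson A ^ m = ⊥} k

/-! Upper bound. The elements `x_J` multiply triangularly: `x_I x_J` is a multiple of `x_J` plus a
combination of `x_K` with `K ⊂ J`. Hence the Jacobson radical consists of the elements that act
strictly triangularly, and each radical factor lowers the filtration by cardinality by one. In type
`B` the longest element `z` is central, lies in the span, and acts on `x_J` by `(-1) ^ #J` modulo
lower terms. On an eigenspace of `z` every other layer is therefore skipped, so each radical factor
costs two layers. Splitting `2 = (1 + z) + (1 - z)` gives `Rad ^ m = 0` for `n ≤ 2 * m`: what could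
survive is a radical multiple of `x_∅`, and it vanishes because `x_∅ ^ 2` is a nonzero multiple of
`x_∅` (`IsTriangularFamily.jacobson_pow_eq_bot`).

Lower bound. Commutators lie in the radical, so it suffices that the commutator of two suitable
`x_I` has a nonzero `m`-th power when `2 * m < n`. Consider the odd functions on the `2 * n`
positions, in particular the odd extensions of `k ↦ k.choose d`. Omitting the first simple
reflection gives an element that is diagonal on these vectors, with eigenvalue `2 * (n - 1 - d)`.
Omitting the last one gives a triangular matrix with nonnegative entries, positive at `(i, d)` for
odd `i ≤ d < n`. The commutator is then again nonnegative, so nothing cancels, and its powers follow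
the path `2m, 2m - 1, 2m - 3, …, 1` (`ascendingCommutator_pow_ne_zero`).

Combinatorial model. `W` is identified with the permutations of `Fin (2 * n)` commuting with
reversal, and descents become comparisons of neighbouring values
(`length_lt_length_mul_simple_iff`). Every `x_J` is the sum of the stable sorting permutations of an
orbit of words. Sorting by pairs of letters multiplies these permutations, which yields the product
formula `ascendingSum_mul` and hence triangularity. -/

section

open Finset Submodule

/-! ### Triangular families: the radical and the bounds on the Loewy length -/

/-- A family `x` in a `ℚ`-algebra indexed by the subsets of a finite set is triangular if left
multiplication by each `x I` is triangular on the family with respect to inclusion. -/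
structure IsTriangularFamily {ι B : Type*} [Fintype ι] [Ring B] [Algebra ℚ B]
    (x : Finset ι → B) : Prop where
  univ_eq_one : x univ = 1
  mul_sub_smul_mem (I J : Finset ι) :
    ∃ c : ℚ, x I * x J - c • x J ∈ span ℚ (x '' {K | K ⊂ J})

namespace IsTriangularFamily

variable {ι B : Type*} [Ring B] [Algebra ℚ B] {x : Finset ι → B}

theorem isLowerSet_ssubset (J : Finset ι) : IsLowerSet {K : Finset ι | K ⊂ J} :=
  fun _ _ h hK => lt_of_le_of_lt h hK

theorem isLowerSet_card_lt (k : ℕ) : IsLowerSet {K : Finset ι | #K < k} :=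
  fun _ _ h hK => lt_of_le_of_lt (card_le_card h) hK

/-- An element acting strictly triangularly decreases the cardinality filtration. -/
theorem mul_mem_of_strict {a v : B} (ha : ∀ J, a * x J ∈ span ℚ (x '' {K | K ⊂ J})) {k : ℕ}
    (hv : v ∈ span ℚ (x '' {K | #K < k + 1})) : a * v ∈ span ℚ (x '' {K | #K < k}) := by
  induction hv using span_induction with
  | mem v hv =>
    obtain ⟨J, hJ, rfl⟩ := hv
    refine span_mono (Set.image_mono fun K hK => ?_) (ha J)
    exact (card_lt_card hK).trans_le (Nat.lt_succ_iff.1 hJ)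
  | zero => simp
  | add u v _ _ ihu ihv => rw [mul_add]; exact add_mem ihu ihv
  | smul r v _ ihv => rw [mul_smul_comm]; exact smul_mem _ r ihv

theorem eq_zero_of_mem_span_card_lt_zero {a : B} (ha : a ∈ span ℚ (x '' {K | #K < 0})) :
    a = 0 := by
  simpa using ha

theorem mul_sub_smul_mem_of_card {z : B} (hz : ∀ J, z * x J - (-1 : ℚ) ^ #J • x J ∈
    span ℚ (x '' {K | K ⊂ J})) {k : ℕ} {v : B} (hv : v ∈ span ℚ (x '' {K | #K < k + 1})) :
    z * v - (-1 : ℚ) ^ k • v ∈ span ℚ (x '' {K | #K < k}) := by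
  induction hv using span_induction with
  | mem v hv =>
    obtain ⟨J, hJ, rfl⟩ := hv
    have h1 : z * x J - (-1 : ℚ) ^ #J • x J ∈ span ℚ (x '' {K | #K < k}) :=
      span_mono (Set.image_mono fun K hK => (card_lt_card hK).trans_le (Nat.lt_succ_iff.1 hJ))
        (hz J)
    rcases (Nat.lt_succ_iff.1 hJ).eq_or_lt with h | h
    · rwa [h] at h1
    · have h2 : x J ∈ span ℚ (x '' {K | #K < k}) := subset_span ⟨J, h, rfl⟩
      convert add_mem h1 (smul_mem _ ((-1 : ℚ) ^ #J - (-1) ^ k) h2) using 1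
      rw [sub_smul]
      abel
  | zero => simp
  | add u v _ _ ihu ihv =>
    convert add_mem ihu ihv using 1
    rw [mul_add, smul_add]
    abel
  | smul r v _ ihv =>
    convert smul_mem _ r ihv using 1
    rw [mul_smul_comm, smul_sub, smul_comm]

/-- The sign eigenspaces skip every other step of the filtration. -/
theorem mem_of_eigen {z : B} (hz : ∀ J, z * x J - (-1 : ℚ) ^ #J • x J ∈ span ℚ (x '' {K | K ⊂ J}))
    {k : ℕ} {v : B} (hv : v ∈ span ℚ (x '' {K | #K < k}))
    (hzv : z * v = (-1 : ℚ) ^ k • v) : v ∈ span ℚ (x '' {K | #K < k - 1}) := by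
  cases k with
  | zero => simpa using hv
  | succ k =>
    -- The top layer gives the sign `(-1) ^ k`, the hypothesis the opposite one; the difference is
    -- `2 * (-1) ^ (k + 1)` times `v`, and this factor normalises it to `v`.
    have h := smul_mem _ ((-1 : ℚ) ^ (k + 1) * 2⁻¹) (mul_sub_smul_mem_of_card hz hv)
    rw [hzv, pow_succ, ← sub_smul, smul_smul] at h
    rcases neg_one_pow_eq_or ℚ k with hk | hk <;> rw [hk] at h <;> norm_num at h <;>
      simpa using h

variable [Fintype ι]

theorem exists_mul_sub_smul_mem (hx : IsTriangularFamily x) {a : B} (ha : a ∈ span ℚ (Set.range x))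
    (J : Finset ι) : ∃ c : ℚ, a * x J - c • x J ∈ span ℚ (x '' {K | K ⊂ J}) := by
  induction ha using span_induction with
  | mem a ha =>
    obtain ⟨I, rfl⟩ := ha
    exact hx.mul_sub_smul_mem I J
  | zero => exact ⟨0, by simp⟩
  | add a b _ _ iha ihb =>
    obtain ⟨c, hc⟩ := iha
    obtain ⟨d, hd⟩ := ihb
    refine ⟨c + d, ?_⟩
    convert add_mem hc hd using 1
    rw [add_mul, add_smul]
    abel
  | smul r a _ iha =>
    obtain ⟨c, hc⟩ := iha
    refine ⟨r * c, ?_⟩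
    convert smul_mem _ r hc using 1
    rw [smul_sub, smul_mul_assoc, mul_smul]

theorem mul_mem_span_of_isLowerSet (hx : IsTriangularFamily x) {P : Set (Finset ι)}
    (hP : IsLowerSet P) {a v : B} (ha : a ∈ span ℚ (Set.range x)) (hv : v ∈ span ℚ (x '' P)) :
    a * v ∈ span ℚ (x '' P) := by
  induction hv using span_induction with
  | mem v hv =>
    obtain ⟨J, hJ, rfl⟩ := hv
    obtain ⟨c, hc⟩ := hx.exists_mul_sub_smul_mem ha J
    have h1 : span ℚ (x '' {K | K ⊂ J}) ≤ span ℚ (x '' P) :=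
      span_mono (Set.image_mono fun K hK => hP hK.subset hJ)
    have h2 : x J ∈ span ℚ (x '' P) := subset_span ⟨J, hJ, rfl⟩
    simpa using add_mem (h1 hc) (smul_mem _ c h2)
  | zero => simp
  | add u v _ _ ihu ihv => rw [mul_add]; exact add_mem ihu ihv
  | smul r v _ ihv => rw [mul_smul_comm]; exact smul_mem _ r ihv

theorem mul_mem (hx : IsTriangularFamily x) {a b : B} (ha : a ∈ span ℚ (Set.range x))
    (hb : b ∈ span ℚ (Set.range x)) : a * b ∈ span ℚ (Set.range x) := by
  rw [← Set.image_univ] at hb ⊢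
  exact hx.mul_mem_span_of_isLowerSet isLowerSet_univ ha hb

/-- The subalgebra spanned by a triangular family. -/
def subalgebra (hx : IsTriangularFamily x) : Subalgebra ℚ B :=
  (span ℚ (Set.range x)).toSubalgebra (subset_span ⟨univ, hx.univ_eq_one⟩)
    fun _ _ ha hb => hx.mul_mem ha hb

theorem mem_subalgebra (hx : IsTriangularFamily x) {a : B} :
    a ∈ hx.subalgebra ↔ a ∈ span ℚ (Set.range x) := Iff.rfl

theorem toSubmodule_subalgebra (hx : IsTriangularFamily x) :
    Subalgebra.toSubmodule hx.subalgebra = span ℚ (Set.range x) := rfl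

theorem mem_of_mem_span_image (hx : IsTriangularFamily x) {P : Set (Finset ι)} {a : B}
    (ha : a ∈ span ℚ (x '' P)) : a ∈ hx.subalgebra :=
  span_mono (Set.image_subset_range _ _) ha

theorem mem_ring_jacobson_iff {R : Type*} [Ring R] {a : R} :
    a ∈ Ring.jacobson R ↔ ∀ b, ∃ c, c * (1 + b * a) = 1 := by
  rw [← Ideal.jacobson_bot, Ideal.mem_jacobson_iff]
  refine forall_congr' fun b => exists_congr fun c => ?_
  rw [Ideal.mem_bot, mul_add, mul_one, sub_eq_zero, mul_assoc, add_comm]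

/-- The Jacobson radical acts strictly triangularly. -/
theorem jacobson_mul_mem (hx : IsTriangularFamily x) {a : hx.subalgebra}
    (ha : a ∈ Ring.jacobson hx.subalgebra) (J : Finset ι) :
    (a : B) * x J ∈ span ℚ (x '' {K | K ⊂ J}) := by
  obtain ⟨c, hc⟩ := hx.exists_mul_sub_smul_mem a.2 J
  rcases eq_or_ne c 0 with rfl | hc0
  · simpa using hc
  -- If `c ≠ 0`, then `1 - c⁻¹ a` is left invertible and yet sends `x J` into the lower span. So `x
  -- J` itself lies there; linear independence of the family is never needed.
  obtain ⟨b, hb⟩ := mem_ring_jacobson_iff.1 ha (algebraMap ℚ _ (-c⁻¹))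
  have hb' : (b : B) * (1 - c⁻¹ • (a : B)) = 1 := by
    have := congrArg (Subtype.val) hb
    simpa [sub_eq_add_neg, ← Algebra.smul_def] using this
  have hv : (1 - c⁻¹ • (a : B)) * x J ∈ span ℚ (x '' {K | K ⊂ J}) := by
    convert smul_mem _ (-c⁻¹) hc using 1
    rw [smul_sub, smul_smul, sub_mul, one_mul, smul_mul_assoc, neg_mul, inv_mul_cancel₀ hc0]
    simp only [neg_smul, one_smul]
    abel
  have hJ : x J ∈ span ℚ (x '' {K | K ⊂ J}) := by
    have := hx.mul_mem_span_of_isLowerSet (isLowerSet_ssubset J) b.2 hv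
    rwa [← mul_assoc, hb', one_mul] at this
  exact hx.mul_mem_span_of_isLowerSet (isLowerSet_ssubset J) a.2 hJ

theorem mem_span_card_lt {a : B} (ha : a ∈ span ℚ (Set.range x)) :
    a ∈ span ℚ (x '' {K | #K < Fintype.card ι + 1}) := by
  rw [← Set.image_univ] at ha
  refine span_mono (Set.image_mono fun K _ => ?_) ha
  exact Nat.lt_succ_iff.2 (card_le_univ K)

/-- Elements acting strictly triangularly lie in the Jacobson radical. -/
theorem mem_jacobson_of_strict (hx : IsTriangularFamily x) {a : hx.subalgebra}
    (ha : ∀ J, (a : B) * x J ∈ span ℚ (x '' {K | K ⊂ J})) :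
    a ∈ Ring.jacobson hx.subalgebra := by
  rw [mem_ring_jacobson_iff]
  intro b
  have hba : ∀ J, ((b : B) * a) * x J ∈ span ℚ (x '' {K | K ⊂ J}) := fun J => by
    rw [mul_assoc]
    exact hx.mul_mem_span_of_isLowerSet (isLowerSet_ssubset J) b.2 (ha J)
  -- Applied to `1`, each factor `b a` loses one layer, so `b a` is nilpotent and `1 + b a` is a
  -- unit.
  have key : ∀ k ≤ Fintype.card ι + 1,
      ((b : B) * a) ^ k ∈ span ℚ (x '' {K | #K < Fintype.card ι + 1 - k}) := by
    intro k
    induction k with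
    | zero =>
      intro _
      rw [_root_.pow_zero]
      exact mem_span_card_lt (one_mem hx.subalgebra)
    | succ k ih =>
      intro hk
      rw [pow_succ']
      refine mul_mem_of_strict hba ?_
      have := ih (by omega)
      rwa [show Fintype.card ι + 1 - k = Fintype.card ι + 1 - (k + 1) + 1 by omega] at this
  have hnil : IsNilpotent (b * a) := by
    refine ⟨Fintype.card ι + 1, Subtype.ext ?_⟩
    have := key _ le_rfl
    rw [Nat.sub_self] at this
    simpa using eq_zero_of_mem_span_card_lt_zero this
  obtain ⟨u, hu⟩ := hnil.isUnit_one_add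
  exact ⟨↑u⁻¹, by rw [← hu]; simp⟩

/-- The diagonal coefficients are scalars, so they cancel in a commutator. -/
theorem commutator_mul_mem (hx : IsTriangularFamily x) {a b : B}
    (ha : a ∈ span ℚ (Set.range x)) (hb : b ∈ span ℚ (Set.range x)) (J : Finset ι) :
    (a * b - b * a) * x J ∈ span ℚ (x '' {K | K ⊂ J}) := by
  obtain ⟨c, hc⟩ := hx.exists_mul_sub_smul_mem ha J
  obtain ⟨d, hd⟩ := hx.exists_mul_sub_smul_mem hb J
  have h1 := hx.mul_mem_span_of_isLowerSet (isLowerSet_ssubset J) ha hd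
  have h2 := hx.mul_mem_span_of_isLowerSet (isLowerSet_ssubset J) hb hc
  convert add_mem (sub_mem h1 h2) (sub_mem (smul_mem _ d hc) (smul_mem _ c hd)) using 1
  simp only [sub_mul, mul_sub, mul_smul_comm, smul_sub, smul_smul, mul_assoc, mul_comm c d]
  abel

section Sign

variable {z : B}

/-- A radical factor lowers the filtration by one layer, and by centrality of `z` it keeps the
eigenvalue. The layer reached carries the wrong sign, so a second layer is lost. -/
theorem jacobson_pow_mul_mem (hx : IsTriangularFamily x)
    (hz : ∀ J, z * x J - (-1 : ℚ) ^ #J • x J ∈ span ℚ (x '' {K | K ⊂ J}))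
    (hcomm : ∀ J, z * x J = x J * z) {k : ℕ} {v : B} (hv : v ∈ span ℚ (x '' {K | #K < k + 1}))
    (hzv : z * v = (-1 : ℚ) ^ k • v) (m : ℕ) {a : hx.subalgebra}
    (ha : a ∈ Ring.jacobson hx.subalgebra ^ m) :
    (a : B) * v ∈ span ℚ (x '' {K | #K < k + 1 - 2 * m}) := by
  have hcomm' : ∀ a ∈ hx.subalgebra, z * a = a * z := by
    intro a ha
    rw [mem_subalgebra] at ha
    induction ha using span_induction with
    | mem v hv => obtain ⟨J, rfl⟩ := hv; exact hcomm J
    | zero => simp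
    | add u v _ _ ihu ihv => rw [mul_add, add_mul, ihu, ihv]
    | smul r v _ ihv => rw [mul_smul_comm, smul_mul_assoc, ihv]
  have heig : ∀ a : hx.subalgebra, z * (a * v) = (-1 : ℚ) ^ k • (a * v) := fun a => by
    rw [← mul_assoc, hcomm' a a.2, mul_assoc, hzv, mul_smul_comm]
  induction m generalizing a with
  | zero => simpa using hx.mul_mem_span_of_isLowerSet (isLowerSet_card_lt _) a.2 hv
  | succ m ih =>
    rw [Ideal.IsTwoSided.pow_succ] at ha
    induction ha using Submodule.mul_induction_on' with
    | mem_mul_mem b hb c hc =>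
      have h1 := ih hc
      -- When `k < 2 * m` the truncated difference is already `0` and the product vanishes.
      rcases Nat.lt_or_ge k (2 * m) with hlt | hge
      · rw [show k + 1 - 2 * m = 0 by omega] at h1
        rw [MulMemClass.coe_mul, mul_assoc, eq_zero_of_mem_span_card_lt_zero h1, mul_zero]
        exact zero_mem _
      · obtain ⟨l, rfl⟩ := Nat.exists_eq_add_of_le hge
        rw [show 2 * m + l + 1 - 2 * m = l + 1 by omega] at h1
        have h2 := mul_mem_of_strict (hx.jacobson_mul_mem hb) h1
        have h3 := heig (b * c)
        rw [MulMemClass.coe_mul, mul_assoc] at h3 ⊢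
        rw [pow_add, pow_mul, neg_one_sq, one_pow, one_mul] at h3
        have h4 := mem_of_eigen hz h2 h3
        rwa [show 2 * m + l + 1 - 2 * (m + 1) = l - 1 by omega]
    | add b _ c _ ihb ihc =>
      rw [AddMemClass.coe_add, add_mul]
      exact add_mem ihb ihc

end Sign

/-- Nothing lies below `∅`, so a radical element kills `x ∅`; a nonzero multiple of `x ∅` does not,
unless `x ∅ = 0`. -/
theorem eq_zero_of_mem_jacobson (hx : IsTriangularFamily x)
    (hempty : ∃ c : ℚ, c ≠ 0 ∧ x ∅ * x ∅ = c • x ∅) {a : hx.subalgebra}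
    (ha : a ∈ Ring.jacobson hx.subalgebra) (ha' : (a : B) ∈ span ℚ (x '' {K | #K < 1})) :
    a = 0 := by
  have h0 : {K : Finset ι | #K < 1} = {∅} := by ext; simp
  rw [h0, Set.image_singleton, mem_span_singleton] at ha'
  obtain ⟨r, hr⟩ := ha'
  obtain ⟨c, hc, hcx⟩ := hempty
  have h1 := hx.jacobson_mul_mem ha ∅
  rw [← hr, smul_mul_assoc, hcx, smul_smul] at h1
  have h2 : {K : Finset ι | K ⊂ ∅} = ∅ := by ext; simp
  rw [h2, Set.image_empty, span_empty, mem_bot, smul_eq_zero, mul_eq_zero] at h1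
  refine Subtype.ext ?_
  rw [ZeroMemClass.coe_zero, ← hr, smul_eq_zero]
  tauto

theorem jacobson_pow_eq_bot (hx : IsTriangularFamily x)
    (hempty : ∃ c : ℚ, c ≠ 0 ∧ x ∅ * x ∅ = c • x ∅) {z : B}
    (hz : ∀ J, z * x J - (-1 : ℚ) ^ #J • x J ∈ span ℚ (x '' {K | K ⊂ J}))
    (hcomm : ∀ J, z * x J = x J * z) (hzz : z * z = 1) {m : ℕ} (hm : m ≠ 0)
    (hmn : Fintype.card ι ≤ 2 * m) : Ring.jacobson hx.subalgebra ^ m = ⊥ := by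
  set n := Fintype.card ι
  rw [eq_bot_iff]
  intro a ha
  have haJ : a ∈ Ring.jacobson hx.subalgebra := Ideal.pow_le_self hm ha
  have hz1 : z ∈ hx.subalgebra := by
    have h := hz univ
    rw [hx.univ_eq_one, mul_one] at h
    simpa using add_mem (hx.mem_of_mem_span_image h)
      (hx.subalgebra.smul_mem (one_mem _) ((-1 : ℚ) ^ #(univ : Finset ι)))
  have hone : (1 : B) ∈ span ℚ (x '' {K | #K < n + 1}) :=
    mem_span_card_lt (one_mem hx.subalgebra)
  -- With `ε` the sign of the top layer, `1 + ε z` starts in layer `n`. Its companion `1 - ε z` has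
  -- eigenvalue `-ε` and starts one layer lower.
  set ε : ℚ := (-1) ^ n with hε
  have hεε : ε * ε = 1 := by rw [hε, ← mul_pow]; simp
  have hmemz : ∀ r : ℚ, 1 + r • z ∈ hx.subalgebra := fun r =>
    add_mem (one_mem _) (hx.subalgebra.smul_mem hz1 r)
  have hp : (1 + ε • z) ∈ span ℚ (x '' {K | #K < n + 1}) := mem_span_card_lt (hmemz ε)
  have hq : (1 - ε • z) ∈ span ℚ (x '' {K | #K < n}) := by
    have := smul_mem _ (-ε) (mul_sub_smul_mem_of_card hz hone)
    rw [mul_one, smul_sub, smul_smul, neg_mul, ← hε, hεε] at this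
    convert this using 1
    simp only [neg_smul, one_smul]
    abel
  have hpz : z * (1 + ε • z) = ε • (1 + ε • z) := by
    rw [mul_add, mul_smul_comm, hzz, smul_add, smul_smul, hεε, mul_one, one_smul, add_comm]
  have hqz : z * (1 - ε • z) = (-ε) • (1 - ε • z) := by
    rw [mul_sub, mul_smul_comm, hzz, smul_sub, smul_smul, neg_mul, hεε, mul_one, neg_smul,
      neg_smul, one_smul]
    abel
  have h1 := hx.jacobson_pow_mul_mem hz hcomm hp hpz m ha
  have h1' : (a * ⟨1 + ε • z, hmemz ε⟩ : hx.subalgebra) = 0 := by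
    refine hx.eq_zero_of_mem_jacobson hempty (Ideal.IsTwoSided.mul_mem_of_left _ haJ) ?_
    refine span_mono (Set.image_mono fun K hK => ?_) h1
    simp only [Set.mem_ofPred_eq] at hK ⊢
    omega
  have h2 : (a : B) * (1 - ε • z) = 0 := by
    cases hn : n with
    | zero =>
      rw [hn] at hq
      rw [eq_zero_of_mem_span_card_lt_zero hq, mul_zero]
    | succ k =>
      rw [hn] at hq
      have hk : -ε = (-1) ^ k := by rw [hε, hn, pow_succ]; ring
      rw [hk] at hqz
      have := hx.jacobson_pow_mul_mem hz hcomm hq hqz m ha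
      rw [show k + 1 - 2 * m = 0 by omega] at this
      exact eq_zero_of_mem_span_card_lt_zero this
  have h3 : (a : B) * (1 + ε • z) = 0 := congrArg Subtype.val h1'
  have h4 : (2 : ℚ) • (a : B) = 0 := by
    have := congrArg₂ (· + ·) h2 h3
    simp only [← mul_add, add_zero] at this
    rw [show (1 - ε • z + (1 + ε • z) : B) = (2 : ℚ) • 1 by rw [two_smul]; abel, mul_smul_comm,
      mul_one] at this
    exact this
  rw [mem_bot]
  exact Subtype.ext ((smul_eq_zero.1 h4).resolve_left two_ne_zero)

theorem isLoewyLength (hx : IsTriangularFamily x)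
    (hempty : ∃ c : ℚ, c ≠ 0 ∧ x ∅ * x ∅ = c • x ∅) {z : B}
    (hz : ∀ J, z * x J - (-1 : ℚ) ^ #J • x J ∈ span ℚ (x '' {K | K ⊂ J}))
    (hcomm : ∀ J, z * x J = x J * z) (hzz : z * z = 1) {m : ℕ}
    (hmn : Fintype.card ι ≤ 2 * (m + 1)) (I J : Finset ι)
    (hne : (x I * x J - x J * x I) ^ m ≠ 0) : IsLoewyLength hx.subalgebra (m + 1) := by
  refine ⟨⟨by omega, hx.jacobson_pow_eq_bot hempty hz hcomm hzz (by omega) hmn⟩, ?_⟩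
  rintro k ⟨-, hk⟩
  by_contra! hlt
  have hI : x I ∈ span ℚ (Set.range x) := subset_span ⟨I, rfl⟩
  have hJ : x J ∈ span ℚ (Set.range x) := subset_span ⟨J, rfl⟩
  let u : hx.subalgebra :=
    ⟨x I * x J - x J * x I, sub_mem (hx.mul_mem hI hJ) (hx.mul_mem hJ hI)⟩
  have hu : u ∈ Ring.jacobson hx.subalgebra :=
    hx.mem_jacobson_of_strict fun K => hx.commutator_mul_mem hI hJ K
  have huk : u ^ k = 0 := by
    have := Ideal.pow_mem_pow hu k
    rwa [hk, mem_bot] at this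
  refine hne ?_
  have h0 : u ^ m = 0 := by
    rw [← Nat.sub_add_cancel (Nat.lt_succ_iff.1 hlt), pow_add, huk, mul_zero]
  exact congrArg Subtype.val h0

end IsTriangularFamily

/-! ### Signed permutations and odd words -/

/-- The group of signed permutations: the permutations of `Fin m` commuting with the reversal. -/
def signedPerm (m : ℕ) : Subgroup (Equiv.Perm (Fin m)) where
  carrier := {w | ∀ a, w a.rev = (w a).rev}
  mul_mem' hv hw a := by rw [Equiv.Perm.mul_apply, Equiv.Perm.mul_apply, hw, hv]
  one_mem' _ := rfl
  inv_mem' {w} hw a := by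
    rw [Equiv.Perm.inv_eq_iff_eq, hw, ← Equiv.Perm.mul_apply, mul_inv_cancel, Equiv.Perm.one_apply]

/-- A word is odd if the reversal of positions reverses the order of its letters. -/
def IsOddWord {m : ℕ} {L : Type*} [LinearOrder L] (f : Fin m → L) : Prop :=
  ∀ a b, f a < f b → f b.rev < f a.rev

namespace IsOddWord

variable {m : ℕ} {L : Type*} [LinearOrder L] {f : Fin m → L}

theorem le (hf : IsOddWord f) {a b : Fin m} (h : f a ≤ f b) : f b.rev ≤ f a.rev := by
  by_contra! hlt
  have := hf _ _ hlt
  rw [Fin.rev_rev, Fin.rev_rev] at this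
  exact this.not_ge h

theorem eq (hf : IsOddWord f) {a b : Fin m} (h : f a = f b) : f a.rev = f b.rev :=
  le_antisymm (hf.le h.ge) (hf.le h.le)

theorem comp_perm (hf : IsOddWord f) {w : Equiv.Perm (Fin m)} (hw : w ∈ signedPerm m) :
    IsOddWord (f ∘ w) := fun a b h => by
  rw [Function.comp_apply, Function.comp_apply, hw, hw]
  exact hf _ _ h

/-- Conjugating the stable sort by reversal gives a permutation with the same characterisation;
uniqueness forces it to commute with reversal. -/
theorem sort_mem (hf : IsOddWord f) : Tuple.sort f ∈ signedPerm m := by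
  obtain ⟨hmono, hties⟩ := Tuple.eq_sort_iff.1 (rfl : Tuple.sort f = Tuple.sort f)
  have key : Fin.revPerm * Tuple.sort f * Fin.revPerm = Tuple.sort f := by
    rw [Tuple.eq_sort_iff]
    constructor
    · intro i j hij
      exact hf.le (hmono (Fin.rev_le_rev.2 hij))
    · intro i j hij h
      refine Fin.rev_lt_rev.2 (hties _ _ (Fin.rev_lt_rev.2 hij) ?_)
      have := hf.eq h
      simpa using this.symm
  intro a
  have := DFunLike.congr_fun key a.rev
  rw [← this]
  simp

theorem lex {L' : Type*} [LinearOrder L'] {g : Fin m → L'} (hf : IsOddWord f)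
    (hg : IsOddWord g) : IsOddWord fun a => toLex (f a, g a) := by
  intro a b h
  rw [Prod.Lex.toLex_lt_toLex] at h ⊢
  rcases h with h | ⟨h, h'⟩
  · exact Or.inl (hf _ _ h)
  · exact Or.inr ⟨(hf.eq h).symm, hg _ _ h'⟩

end IsOddWord

/-! ### Descent sums as sums of sorting permutations, and their product -/

section Steps

variable {n : ℕ}

/-- The left position moved by the `i`-th simple signed permutation. -/
def stepLeft (i : Fin n) : Fin (2 * n) := ⟨i, by omega⟩

/-- The right position moved by the `i`-th simple signed permutation. -/
def stepRight (i : Fin n) : Fin (2 * n) := ⟨i + 1, by omega⟩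

theorem stepLeft_lt_stepRight (i : Fin n) : stepLeft i < stepRight i :=
  Fin.mk_lt_mk.2 (Nat.lt_succ_self _)

/-- The steps at which the letter of a word does not change. -/
def ties {L : Type*} [DecidableEq L] (f : Fin (2 * n) → L) : Finset (Fin n) :=
  {i | f (stepLeft i) = f (stepRight i)}

theorem mem_ties {L : Type*} [DecidableEq L] {f : Fin (2 * n) → L} {i : Fin n} :
    i ∈ ties f ↔ f (stepLeft i) = f (stepRight i) := by simp [ties]

/-- A property of consecutive positions which is stable under reversal follows from its validity
on the steps. -/
theorem forall_consecutive {P : Fin (2 * n) → Fin (2 * n) → Prop}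
    (hrev : ∀ a b, P a b → P b.rev a.rev) (hP : ∀ i : Fin n, P (stepLeft i) (stepRight i))
    (p : ℕ) (hp : p + 1 < 2 * n) : P ⟨p, by omega⟩ ⟨p + 1, hp⟩ := by
  rcases Nat.lt_or_ge p n with h | h
  · exact hP ⟨p, h⟩
  · convert hrev _ _ (hP ⟨2 * n - 2 - p, by omega⟩) using 1 <;>
      simp only [stepLeft, stepRight, Fin.ext_iff, Fin.val_rev] <;> omega

/-- A monotone word with equal letters at `a` and `b` is constant in between, so the inequality is a
chain of ties. Oddness transports the hypothesis to the mirrored steps. -/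
theorem lt_of_forall_ties {L : Type*} [LinearOrder L] {φ : Fin (2 * n) → L} (hφ : Monotone φ)
    (hodd : IsOddWord φ) {w : Equiv.Perm (Fin (2 * n))} (hw : w ∈ signedPerm (2 * n))
    (h : ∀ i ∈ ties φ, w (stepLeft i) < w (stepRight i)) {a b : Fin (2 * n)} (hab : a < b)
    (heq : φ a = φ b) : w a < w b := by
  have hstep := forall_consecutive (P := fun a b => φ a = φ b → w a < w b)
    (fun a b hab h => by
      rw [hw, hw, Fin.rev_lt_rev]
      refine hab ?_
      have := hodd.eq h
      rw [Fin.rev_rev, Fin.rev_rev] at this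
      exact this.symm) (fun i hi => h i (mem_ties.2 hi))
  obtain ⟨a, ha⟩ := a
  obtain ⟨b, hb⟩ := b
  obtain ⟨k, rfl⟩ := Nat.exists_eq_add_of_lt (Fin.mk_lt_mk.1 hab)
  induction k with
  | zero => exact hstep a hb heq
  | succ k ih =>
    have h1 : φ ⟨a, ha⟩ ≤ φ ⟨a + k + 1, by omega⟩ := hφ (Fin.mk_le_mk.2 (by omega))
    have h2 : φ ⟨a + k + 1, by omega⟩ ≤ φ ⟨a + (k + 1) + 1, hb⟩ := hφ (Fin.mk_le_mk.2 (by omega))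
    have h3 := le_antisymm h1 (heq ▸ h2)
    exact (ih _ (Fin.mk_lt_mk.2 (by omega)) h3).trans
      (hstep (a + k + 1) hb (h3.symm.trans heq))

open Classical in
/-- The signed permutations which are increasing along the steps in `J`. -/
noncomputable def ascendingPerms (J : Finset (Fin n)) : Finset (Equiv.Perm (Fin (2 * n))) :=
  {w | w ∈ signedPerm (2 * n) ∧ ∀ i ∈ J, w (stepLeft i) < w (stepRight i)}

theorem mem_ascendingPerms {J : Finset (Fin n)} {w : Equiv.Perm (Fin (2 * n))} :
    w ∈ ascendingPerms J ↔
      w ∈ signedPerm (2 * n) ∧ ∀ i ∈ J, w (stepLeft i) < w (stepRight i) := by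
  simp [ascendingPerms]

/-- The sum of the signed permutations which are increasing along the steps in `J`. -/
noncomputable def ascendingSum (J : Finset (Fin n)) :
    MonoidAlgebra ℚ (Equiv.Perm (Fin (2 * n))) :=
  ∑ w ∈ ascendingPerms J, MonoidAlgebra.of ℚ _ w

/-- With `sort_mem_ascendingPerms`, this makes `w ↦ φ ∘ w⁻¹` a bijection from `ascendingPerms (ties
φ)` onto the admissible rearrangements of `φ`. -/
theorem sort_comp_symm_eq {L : Type*} [LinearOrder L] {φ : Fin (2 * n) → L} (hφ : Monotone φ)
    (hodd : IsOddWord φ) {w : Equiv.Perm (Fin (2 * n))} (hw : w ∈ ascendingPerms (ties φ)) :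
    Tuple.sort (φ ∘ (w⁻¹ : Equiv.Perm _)) = w := by
  obtain ⟨hw1, hw2⟩ := mem_ascendingPerms.1 hw
  refine (Tuple.eq_sort_iff.2 ⟨?_, fun i j hij h => ?_⟩).symm
  · intro a b hab
    simpa using hφ hab
  · exact lt_of_forall_ties hφ hodd hw1 hw2 hij (by simpa using h)

theorem sort_mem_ascendingPerms {L : Type*} [LinearOrder L] {f : Fin (2 * n) → L}
    (hf : IsOddWord f) : Tuple.sort f ∈ ascendingPerms (ties (f ∘ Tuple.sort f)) := by
  refine mem_ascendingPerms.2 ⟨hf.sort_mem, fun i hi => ?_⟩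
  exact (Tuple.eq_sort_iff.1 (rfl : Tuple.sort f = Tuple.sort f)).2 _ _ (stepLeft_lt_stepRight i)
    (mem_ties.1 hi)

open Classical in
/-- The sum of the sorting permutations of a stable set of odd words is a sum of the elements
`ascendingSum J`, one for each increasing word. -/
theorem sum_sort {L : Type*} [LinearOrder L] (Ω : Finset (Fin (2 * n) → L))
    (hodd : ∀ f ∈ Ω, IsOddWord f) (hΩ : ∀ f ∈ Ω, ∀ w ∈ signedPerm (2 * n), f ∘ w ∈ Ω) :
    ∑ f ∈ Ω, MonoidAlgebra.of ℚ _ (Tuple.sort f) =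
      ∑ φ ∈ Ω with Monotone φ, ascendingSum (ties φ) := by
  rw [← sum_fiberwise_of_maps_to (t := Ω.filter Monotone) (g := fun f => f ∘ Tuple.sort f)]
  · refine sum_congr rfl fun φ hφ => ?_
    obtain ⟨hφΩ, hφ⟩ := mem_filter.1 hφ
    refine sum_bij' (fun f _ => Tuple.sort f) (fun w _ => φ ∘ (w⁻¹ : Equiv.Perm _)) ?_ ?_ ?_ ?_ ?_
    · intro f hf
      obtain ⟨hfΩ, rfl⟩ := mem_filter.1 hf
      exact sort_mem_ascendingPerms (hodd f hfΩ)
    · intro w hw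
      have hw1 := (mem_ascendingPerms.1 hw).1
      refine mem_filter.2 ⟨hΩ _ hφΩ _ (inv_mem hw1), ?_⟩
      rw [sort_comp_symm_eq hφ (hodd _ hφΩ) hw]
      ext a
      simp
    · intro f hf
      obtain ⟨hf, rfl⟩ := mem_filter.1 hf
      ext a
      simp
    · intro w hw
      exact sort_comp_symm_eq hφ (hodd _ hφΩ) hw
    · intro f _
      rfl
  · intro f hf
    exact mem_filter.2 ⟨hΩ f hf _ (hodd f hf).sort_mem, Tuple.monotone_sort f⟩

/-- The standard increasing word whose letter does not change exactly at the steps in `J`. -/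
def stdWord (J : Finset (Fin n)) (p : Fin (2 * n)) : ℕ :=
  -- Reversal sends the step from `j` to `j + 1` to step `2 * n - 2 - j`; the minimum picks the
  -- representative among the first `n` steps.
  ∑ j ∈ range p, if ∃ i ∈ J, (i : ℕ) = min j (2 * n - 2 - j) then 0 else 1

theorem stdWord_monotone (J : Finset (Fin n)) : Monotone (stdWord J) := fun _ _ h =>
  sum_le_sum_of_subset (range_mono h)

/-- The step weights are symmetric, so mirror letters have a constant sum; this is what makes the
word odd. -/
theorem stdWord_add_rev (J : Finset (Fin n)) (p : Fin (2 * n)) :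
    stdWord J p + stdWord J p.rev =
      ∑ j ∈ range (2 * n - 1), if ∃ i ∈ J, (i : ℕ) = min j (2 * n - 2 - j) then 0 else 1 := by
  set t : ℕ → ℕ := fun j => if ∃ i ∈ J, (i : ℕ) = min j (2 * n - 2 - j) then 0 else 1 with ht
  have hp : (p : ℕ) + (2 * n - 1 - p) = 2 * n - 1 := by omega
  change ∑ j ∈ range p, t j + ∑ j ∈ range p.rev, t j = ∑ j ∈ range (2 * n - 1), t j
  rw [← hp, sum_range_add, ← sum_range_reflect _ (2 * n - 1 - (p : ℕ)), Fin.val_rev]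
  congr 1
  refine sum_congr (by congr 1; omega) fun j hj => ?_
  rw [mem_range] at hj
  simp only [ht]
  congr! 4
  rw [show 2 * n - 2 - (↑p + (2 * n - 1 - ↑p - 1 - j)) = j by omega,
    show ↑p + (2 * n - 1 - ↑p - 1 - j) = 2 * n - 2 - j by omega, min_comm]

theorem isOddWord_stdWord (J : Finset (Fin n)) : IsOddWord (stdWord J) := fun a b h => by
  have h1 := stdWord_add_rev J a
  have h2 := stdWord_add_rev J b
  omega

theorem ties_stdWord (J : Finset (Fin n)) : ties (stdWord J) = J := by
  ext i
  rw [mem_ties, stdWord, stdWord, stepLeft, stepRight, sum_range_succ, left_eq_add]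
  have : min (i : ℕ) (2 * n - 2 - i) = i := by omega
  rw [this]
  simp [← Fin.ext_iff]

open Classical in
/-- The orbit of the standard word of type `J`. -/
noncomputable def wordOrbit (J : Finset (Fin n)) : Finset (Fin (2 * n) → ℕ) :=
  image (fun w : Equiv.Perm (Fin (2 * n)) => stdWord J ∘ w) {w | w ∈ signedPerm (2 * n)}

theorem mem_wordOrbit {J : Finset (Fin n)} {f : Fin (2 * n) → ℕ} :
    f ∈ wordOrbit J ↔ ∃ w ∈ signedPerm (2 * n), stdWord J ∘ w = f := by
  simp [wordOrbit]

theorem isOddWord_of_mem_wordOrbit {J : Finset (Fin n)} {f : Fin (2 * n) → ℕ}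
    (hf : f ∈ wordOrbit J) : IsOddWord f := by
  obtain ⟨w, hw, rfl⟩ := mem_wordOrbit.1 hf
  exact (isOddWord_stdWord J).comp_perm hw

theorem comp_mem_wordOrbit {J : Finset (Fin n)} {f : Fin (2 * n) → ℕ} (hf : f ∈ wordOrbit J)
    {w : Equiv.Perm (Fin (2 * n))} (hw : w ∈ signedPerm (2 * n)) : f ∘ w ∈ wordOrbit J := by
  obtain ⟨v, hv, rfl⟩ := mem_wordOrbit.1 hf
  exact mem_wordOrbit.2 ⟨v * w, mul_mem hv hw, rfl⟩

theorem eq_stdWord_of_monotone {J : Finset (Fin n)} {f : Fin (2 * n) → ℕ}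
    (hf : f ∈ wordOrbit J) (hmono : Monotone f) : f = stdWord J := by
  obtain ⟨w, hw, rfl⟩ := mem_wordOrbit.1 hf
  exact Tuple.unique_monotone (τ := 1) hmono (by simpa using stdWord_monotone J)

theorem sum_sort_wordOrbit (J : Finset (Fin n)) :
    ∑ f ∈ wordOrbit J, MonoidAlgebra.of ℚ _ (Tuple.sort f) = ascendingSum J := by
  classical
  rw [sum_sort _ (fun f => isOddWord_of_mem_wordOrbit) (fun f hf w => comp_mem_wordOrbit hf)]
  rw [sum_eq_single (stdWord J), ties_stdWord]
  · intro f hf hne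
    exact (hne (eq_stdWord_of_monotone (mem_filter.1 hf).1 (mem_filter.1 hf).2)).elim
  · intro h
    exact (h (mem_filter.2 ⟨mem_wordOrbit.2 ⟨1, one_mem _, rfl⟩, stdWord_monotone J⟩)).elim

/-- Sorting a word lexicographically refined by a second one. -/
theorem sort_lex {m : ℕ} {L L' : Type*} [LinearOrder L] [LinearOrder L'] (f : Fin m → L)
    (g : Fin m → L') :
    Tuple.sort (fun a => toLex (f ((Tuple.sort g)⁻¹ a), g a)) = Tuple.sort g * Tuple.sort f := by
  have hinv : ∀ a, (Tuple.sort g)⁻¹ (Tuple.sort g a) = a := (Tuple.sort g).symm_apply_apply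
  obtain ⟨hf1, hf2⟩ := Tuple.eq_sort_iff.1 (rfl : Tuple.sort f = Tuple.sort f)
  obtain ⟨hg1, hg2⟩ := Tuple.eq_sort_iff.1 (rfl : Tuple.sort g = Tuple.sort g)
  refine (Tuple.eq_sort_iff.2 ⟨fun i j hij => ?_, fun i j hij h => ?_⟩).symm
  · rw [Function.comp_apply, Function.comp_apply, Prod.Lex.toLex_le_toLex]
    simp only [Equiv.Perm.mul_apply, hinv]
    rcases (hf1 hij).lt_or_eq with h | h
    · exact Or.inl h
    · rcases hij.eq_or_lt with rfl | hij
      · exact Or.inr ⟨rfl, le_rfl⟩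
      · exact Or.inr ⟨h, hg1 (hf2 i j hij h).le⟩
  · simp only [EmbeddingLike.apply_eq_iff_eq, Prod.mk.injEq, Equiv.Perm.mul_apply,
      hinv] at h
    exact hg2 _ _ (hf2 i j hij h.1) h.2

open Classical in
/-- The product formula for the elements `ascendingSum J`. -/
theorem ascendingSum_mul (I J : Finset (Fin n)) :
    ascendingSum I * ascendingSum J =
      ∑ φ ∈ image (fun p : (Fin (2 * n) → ℕ) × (Fin (2 * n) → ℕ) => fun a => toLex (p.1 a, p.2 a))
        (wordOrbit J ×ˢ wordOrbit I) with Monotone φ, ascendingSum (ties φ) := by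
  have hinj : Function.Injective
      (fun p : (Fin (2 * n) → ℕ) × (Fin (2 * n) → ℕ) => fun a => toLex (p.1 a, p.2 a)) := by
    intro p q h
    ext a
    · exact congrArg (fun x => (ofLex (x a)).1) h
    · exact congrArg (fun x => (ofLex (x a)).2) h
  rw [← sum_sort, sum_image hinj.injOn, sum_product_right, ← sum_sort_wordOrbit I,
    ← sum_sort_wordOrbit J, sum_mul]
  · refine sum_congr rfl fun g hg => ?_
    have hs := (isOddWord_of_mem_wordOrbit hg).sort_mem
    rw [mul_sum]
    -- For fixed `g`, this substitution permutes the orbit of `f` and turns the product of two sorts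
    -- into the sort of one word of pairs.
    refine sum_bij' (fun f _ => f ∘ ((Tuple.sort g)⁻¹ : Equiv.Perm _))
      (fun f _ => f ∘ Tuple.sort g) (fun f hf => comp_mem_wordOrbit hf (inv_mem hs))
      (fun f hf => comp_mem_wordOrbit hf hs) ?_ ?_ ?_
    · intro f _
      ext a
      simp
    · intro f _
      ext a
      simp
    · intro f _
      rw [← map_mul, ← sort_lex]
      rfl
  · intro f hf
    obtain ⟨⟨f, g⟩, hfg, rfl⟩ := mem_image.1 hf
    rw [mem_product] at hfg
    exact (isOddWord_of_mem_wordOrbit hfg.1).lex (isOddWord_of_mem_wordOrbit hfg.2)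
  · intro f hf w hw
    obtain ⟨⟨f, g⟩, hfg, rfl⟩ := mem_image.1 hf
    rw [mem_product] at hfg
    exact mem_image.2 ⟨(f ∘ w, g ∘ w), mem_product.2
      ⟨comp_mem_wordOrbit hfg.1 hw, comp_mem_wordOrbit hfg.2 hw⟩, rfl⟩

/-- In an increasing word of pairs the first component is increasing, hence equal to `stdWord J`.
Ties of pairs are ties of that component, so only subsets of `J` occur; `c` counts the words
attaining `J`. -/
theorem exists_ascendingSum_mul_sub_mem (I J : Finset (Fin n)) :
    ∃ c : ℚ, ascendingSum I * ascendingSum J - c • ascendingSum J ∈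
      span ℚ (ascendingSum '' {K | K ⊂ J}) := by
  classical
  rw [ascendingSum_mul]
  set Φ := (image (fun p : (Fin (2 * n) → ℕ) × (Fin (2 * n) → ℕ) => fun a => toLex (p.1 a, p.2 a))
    (wordOrbit J ×ˢ wordOrbit I)).filter Monotone with hΦ
  have hties : ∀ φ ∈ Φ, ties φ ⊆ J := by
    intro φ hφ i hi
    obtain ⟨hφ, hmono⟩ := mem_filter.1 hφ
    obtain ⟨⟨f, g⟩, hfg, rfl⟩ := mem_image.1 hφ
    rw [mem_product] at hfg
    have hf : Monotone f := fun a b hab => by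
      have := Prod.Lex.toLex_le_toLex.1 (hmono hab)
      rcases this with h | h
      exacts [h.le, h.1.le]
    rw [mem_ties] at hi
    rw [← ties_stdWord J, ← eq_stdWord_of_monotone hfg.1 hf, mem_ties]
    exact congrArg (fun x => (ofLex x).1) hi
  refine ⟨#{φ ∈ Φ | ties φ = J}, ?_⟩
  rw [← sum_filter_add_sum_filter_not Φ (fun φ => ties φ = J)]
  have h1 : ∑ φ ∈ Φ with ties φ = J, ascendingSum (ties φ) =
      (#{φ ∈ Φ | ties φ = J} : ℚ) • ascendingSum J := by
    rw [sum_congr rfl (g := fun _ => ascendingSum J) (fun φ hφ => by rw [(mem_filter.1 hφ).2]),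
      sum_const, Nat.cast_smul_eq_nsmul]
  rw [h1, add_sub_cancel_left]
  refine sum_mem fun φ hφ => subset_span ⟨ties φ, ?_, rfl⟩
  obtain ⟨hφ, hne⟩ := mem_filter.1 hφ
  exact (hties φ hφ).ssubset_of_ne hne

end Steps

/-! ### Extreme descent sums and the longest element -/

section Steps

variable {n : ℕ}

theorem strictMono_of_forall_steps {w : Equiv.Perm (Fin (2 * n))} (hw : w ∈ signedPerm (2 * n))
    (h : ∀ i, w (stepLeft i) < w (stepRight i)) : StrictMono w := fun _ _ hab =>
  lt_of_forall_ties (φ := fun _ => (0 : ℕ)) monotone_const (fun _ _ h => h) hw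
    (fun i _ => h i) hab rfl

theorem perm_eq_one_of_strictMono {m : ℕ} {w : Equiv.Perm (Fin m)} (hw : StrictMono w) : w = 1 := by
  have h : ((1 : Equiv.Perm (Fin m)) : Fin m → Fin m) ∘ w =
      (1 : Equiv.Perm (Fin m)) ∘ (1 : Equiv.Perm (Fin m)) :=
    Tuple.unique_monotone (f := id) (σ := w) (τ := 1) hw.monotone monotone_id
  exact Equiv.ext fun a => congrFun h a

theorem ascendingPerms_univ : ascendingPerms (univ : Finset (Fin n)) = {1} := by
  ext w
  rw [mem_ascendingPerms, mem_singleton]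
  constructor
  · rintro ⟨hw, h⟩
    exact perm_eq_one_of_strictMono (strictMono_of_forall_steps hw fun i => h i (mem_univ i))
  · rintro rfl
    exact ⟨one_mem _, fun i _ => stepLeft_lt_stepRight i⟩

theorem ascendingSum_univ : ascendingSum (univ : Finset (Fin n)) = 1 := by
  rw [ascendingSum, ascendingPerms_univ, sum_singleton, map_one]

theorem ascendingSum_empty_mul_self :
    ∃ c : ℚ, c ≠ 0 ∧
      ascendingSum (∅ : Finset (Fin n)) * ascendingSum ∅ = c • ascendingSum ∅ := by
  have hmem : ∀ w, w ∈ ascendingPerms (∅ : Finset (Fin n)) ↔ w ∈ signedPerm (2 * n) := fun w => by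
    simp [mem_ascendingPerms]
  refine ⟨#(ascendingPerms (∅ : Finset (Fin n))), ?_, ?_⟩
  · exact Nat.cast_ne_zero.2 (card_ne_zero_of_mem ((hmem 1).2 (one_mem _)))
  · conv_lhs => rw [ascendingSum, sum_mul]
    rw [sum_congr rfl (g := fun _ => ascendingSum ∅), sum_const, Nat.cast_smul_eq_nsmul]
    intro v hv
    rw [ascendingSum, mul_sum]
    rw [hmem] at hv
    refine sum_bij' (fun w _ => v * w) (fun w _ => v⁻¹ * w) ?_ ?_ ?_ ?_ ?_
    · intro w hw
      exact (hmem _).2 (mul_mem hv ((hmem _).1 hw))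
    · intro w hw
      exact (hmem _).2 (mul_mem (inv_mem hv) ((hmem _).1 hw))
    · intro w _; simp
    · intro w _; simp
    · intro w _; rw [map_mul]

theorem revPerm_mem_signedPerm (m : ℕ) : Fin.revPerm ∈ signedPerm m := fun _ => rfl

theorem of_revPerm_mul_self (m : ℕ) :
    MonoidAlgebra.of ℚ (Equiv.Perm (Fin m)) Fin.revPerm * MonoidAlgebra.of ℚ _ Fin.revPerm = 1 := by
  rw [← map_mul, ← map_one (MonoidAlgebra.of ℚ _)]
  congr 1
  ext a
  simp

theorem of_revPerm_mul_comm (J : Finset (Fin n)) :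
    MonoidAlgebra.of ℚ _ Fin.revPerm * ascendingSum J =
      ascendingSum J * MonoidAlgebra.of ℚ _ Fin.revPerm := by
  rw [ascendingSum, mul_sum, sum_mul]
  refine sum_congr rfl fun w hw => ?_
  rw [← map_mul, ← map_mul]
  congr 1
  ext a : 1
  exact ((mem_ascendingPerms.1 hw).1 a).symm

/-- The longest element as an alternating sum. -/
theorem of_revPerm_mul_ascendingSum (J : Finset (Fin n)) :
    MonoidAlgebra.of ℚ _ Fin.revPerm * ascendingSum J =
      ∑ K ∈ J.powerset, (-1 : ℚ) ^ #K • ascendingSum K := by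
  classical
  have h1 : ∀ K : Finset (Fin n), ascendingSum K =
      ∑ w with w ∈ signedPerm (2 * n), if ∀ i ∈ K, w (stepLeft i) < w (stepRight i) then
        MonoidAlgebra.of ℚ _ w else 0 := fun K => by
    rw [ascendingSum, ← sum_filter, filter_filter]
    refine sum_congr ?_ fun _ _ => rfl
    ext w
    simp [mem_ascendingPerms]
  -- Inclusion–exclusion: the alternating sum over sets of ascents inside `J` survives only when `w`
  -- descends on all of `J`.
  have h2 : ∀ w : Equiv.Perm (Fin (2 * n)), ∑ K ∈ J.powerset, (-1 : ℚ) ^ #K •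
      (if ∀ i ∈ K, w (stepLeft i) < w (stepRight i) then MonoidAlgebra.of ℚ _ w else 0) =
      if ∀ i ∈ J, w (stepRight i) < w (stepLeft i) then MonoidAlgebra.of ℚ _ w else 0 := by
    intro w
    simp only [smul_ite, smul_zero]
    rw [← sum_filter, ← sum_smul]
    have h3 : {K ∈ J.powerset | ∀ i ∈ K, w (stepLeft i) < w (stepRight i)} =
        powerset {i ∈ J | w (stepLeft i) < w (stepRight i)} := by
      ext K
      simp only [mem_filter, mem_powerset, subset_iff]
      exact ⟨fun h i hi => ⟨h.1 hi, h.2 i hi⟩, fun h =>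
        ⟨fun i hi => (h hi).1, fun i hi => (h hi).2⟩⟩
    have h4 := congrArg (Int.cast : ℤ → ℚ)
      (sum_powerset_neg_one_pow_card (x := {i ∈ J | w (stepLeft i) < w (stepRight i)}))
    push_cast at h4
    rw [h3, h4]
    have h5 : {i ∈ J | w (stepLeft i) < w (stepRight i)} = ∅ ↔
        ∀ i ∈ J, w (stepRight i) < w (stepLeft i) := by
      rw [filter_eq_empty_iff]
      refine forall₂_congr fun i _ => ?_
      rw [not_lt, le_iff_lt_or_eq, or_iff_left]
      exact fun h => (stepLeft_lt_stepRight i).ne' (w.injective h)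
    simp only [h5, ite_smul, one_smul, zero_smul]
  simp only [h1, smul_sum]
  rw [sum_comm, sum_congr rfl fun w _ => h2 w, mul_sum]
  -- Left multiplication by the reversal exchanges ascents and descents.
  refine sum_bij' (fun w _ => Fin.revPerm * w) (fun w _ => Fin.revPerm * w) ?_ ?_ ?_ ?_ ?_
  · simp only [mem_filter, mem_univ, true_and]
    exact fun w hw => mul_mem (revPerm_mem_signedPerm _) hw
  · simp only [mem_filter, mem_univ, true_and]
    exact fun w hw => mul_mem (revPerm_mem_signedPerm _) hw
  · intro w _; ext; simp
  · intro w _; ext; simp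
  · intro w _
    simp only [mul_ite, mul_zero, ← map_mul, Equiv.Perm.mul_apply, Fin.revPerm_apply,
      Fin.rev_lt_rev]

theorem of_revPerm_mul_sub_mem (J : Finset (Fin n)) :
    MonoidAlgebra.of ℚ _ Fin.revPerm * ascendingSum J - (-1 : ℚ) ^ #J • ascendingSum J ∈
      span ℚ (ascendingSum '' {K | K ⊂ J}) := by
  classical
  rw [of_revPerm_mul_ascendingSum, ← sum_erase_add _ _ (mem_powerset_self J), add_sub_cancel_right]
  refine sum_mem fun K hK => smul_mem _ _ (subset_span ⟨K, ?_, rfl⟩)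
  rw [mem_erase, mem_powerset] at hK
  exact hK.2.ssubset_of_ne hK.1

end Steps

/-! ### The action on odd functions -/

section Representation

variable {n : ℕ}

/-- The permutation representation of the group algebra on functions. -/
noncomputable def permRep (m : ℕ) :
    MonoidAlgebra ℚ (Equiv.Perm (Fin m)) →ₐ[ℚ] Module.End ℚ (Fin m → ℚ) :=
  MonoidAlgebra.lift ℚ _ _
    { toFun := fun w => LinearMap.funLeft ℚ ℚ (w⁻¹ : Equiv.Perm (Fin m))
      map_one' := by ext; simp
      map_mul' := fun v w => by ext; simp [mul_inv_rev] }

theorem permRep_of_apply {m : ℕ} (w : Equiv.Perm (Fin m)) (u : Fin m → ℚ) (q : Fin m) :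
    permRep m (MonoidAlgebra.of ℚ _ w) u q = u (w⁻¹ q) := by
  rw [permRep, MonoidAlgebra.lift_of]
  rfl

theorem permRep_ascendingSum_odd (J : Finset (Fin n)) {u : Fin (2 * n) → ℚ}
    (hu : ∀ a, u a.rev = -u a) (q : Fin (2 * n)) :
    permRep _ (ascendingSum J) u q.rev = -permRep _ (ascendingSum J) u q := by
  simp only [ascendingSum, map_sum, LinearMap.sum_apply, Finset.sum_apply]
  rw [← sum_neg_distrib]
  refine sum_congr rfl fun w hw => ?_
  rw [permRep_of_apply, permRep_of_apply, inv_mem (mem_ascendingPerms.1 hw).1, hu]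

/-- The positions in the upper half. -/
def upper (i : Fin n) : Fin (2 * n) := ⟨n + i, by omega⟩

theorem upper_injective : Function.Injective (upper : Fin n → Fin (2 * n)) := fun i j h => by
  simpa [upper, Fin.ext_iff] using h

theorem eq_upper_or_eq_rev (a : Fin (2 * n)) : ∃ i, a = upper i ∨ a = (upper i).rev := by
  rcases Nat.lt_or_ge a n with h | h
  · refine ⟨⟨n - 1 - a, by omega⟩, Or.inr ?_⟩
    simp only [upper, Fin.ext_iff, Fin.val_rev]
    omega
  · refine ⟨⟨a - n, by omega⟩, Or.inl ?_⟩
    simp only [upper, Fin.ext_iff]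
    omega

theorem upper_ne_rev_upper (i j : Fin n) : upper i ≠ (upper j).rev := by
  simp only [upper, ne_eq, Fin.ext_iff, Fin.val_rev]
  omega

theorem sum_eq_sum_upper {M : Type*} [AddCommMonoid M] (F : Fin (2 * n) → M) :
    ∑ a, F a = ∑ i, (F (upper i) + F (upper i).rev) := by
  rw [sum_add_distrib, ← (finCongr (two_mul n).symm).sum_comp, Fin.sum_univ_add, add_comm]
  congr 1
  rw [← Equiv.sum_comp Fin.revPerm]
  refine sum_congr rfl fun i _ => congrArg F ?_
  simp only [upper, Fin.ext_iff, Fin.val_rev, finCongr_apply, Fin.val_cast, Fin.val_castAdd,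
    Fin.revPerm_apply]
  omega

theorem odd_ext {u v : Fin (2 * n) → ℚ} (hu : ∀ a, u a.rev = -u a) (hv : ∀ a, v a.rev = -v a)
    (h : ∀ i, u (upper i) = v (upper i)) : u = v := by
  ext a
  obtain ⟨i, rfl | rfl⟩ := eq_upper_or_eq_rev a
  · exact h i
  · rw [hu, hv, h]

/-- The rank of a position in the sorted order. -/
theorem sort_inv_apply {m : ℕ} {L : Type*} [LinearOrder L] (f : Fin m → L) (q : Fin m) :
    (((Tuple.sort f)⁻¹ q : Fin m) : ℕ) = #{a | f a < f q ∨ f a = f q ∧ a < q} := by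
  obtain ⟨hmono, hties⟩ := Tuple.eq_sort_iff.1 (rfl : Tuple.sort f = Tuple.sort f)
  set σ := Tuple.sort f with hσ
  have key : ∀ i j, i < j ↔ f (σ i) < f (σ j) ∨ f (σ i) = f (σ j) ∧ σ i < σ j := by
    have h1 : ∀ i j, i < j → f (σ i) < f (σ j) ∨ f (σ i) = f (σ j) ∧ σ i < σ j := by
      intro i j hij
      rcases (hmono hij.le).lt_or_eq with h | h
      · exact Or.inl h
      · exact Or.inr ⟨h, hties i j hij h⟩
    intro i j
    refine ⟨h1 i j, fun h => ?_⟩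
    by_contra hij
    rcases (not_lt.1 hij).eq_or_lt with rfl | hji
    · simp at h
    · rcases h1 j i hji with h' | h' <;> rcases h with h | h
      · exact absurd h h'.not_gt
      · exact absurd h.1 h'.ne'
      · exact absurd h'.1 h.ne'
      · exact absurd h.2 h'.2.not_gt
  rw [← Fin.card_Iio, ← card_map σ.toEmbedding]
  congr 1
  ext a
  rw [mem_map_equiv, mem_Iio, mem_filter, key]
  simp

/-- The odd extensions of the binomial polynomials. -/
def binomVec (n d : ℕ) (q : Fin (2 * n)) : ℚ :=
  if n ≤ q then ((q - n : ℕ).choose d : ℚ) else -((n - 1 - q : ℕ).choose d : ℚ)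

theorem binomVec_of_le {d : ℕ} {q : Fin (2 * n)} {k : ℕ} (h : (q : ℕ) = n + k) :
    binomVec n d q = k.choose d := by
  rw [binomVec, if_pos (by omega), h, Nat.add_sub_cancel_left]

theorem binomVec_of_lt {d : ℕ} {q : Fin (2 * n)} {k : ℕ} (h : (q : ℕ) + k + 1 = n) :
    binomVec n d q = -(k.choose d : ℚ) := by
  rw [binomVec, if_neg (by omega), show n - 1 - (q : ℕ) = k by omega]

theorem binomVec_upper (d : ℕ) (i : Fin n) : binomVec n d (upper i) = (i : ℕ).choose d :=
  binomVec_of_le rfl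

theorem binomVec_rev (d : ℕ) (a : Fin (2 * n)) : binomVec n d a.rev = -binomVec n d a := by
  rcases Nat.lt_or_ge a n with h | h
  · rw [binomVec_of_lt (q := a) (k := n - 1 - a) (by omega),
      binomVec_of_le (k := n - 1 - a) (by rw [Fin.val_rev]; omega), neg_neg]
  · rw [binomVec_of_le (q := a) (k := a - n) (by omega),
      binomVec_of_lt (k := a - n) (by rw [Fin.val_rev]; omega)]

theorem sort_inv_apply_eq_sum {L : Type*} [LinearOrder L] (f : Fin (2 * n) → L)
    (q : Fin (2 * n)) : (((Tuple.sort f)⁻¹ q : Fin (2 * n)) : ℕ) =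
      ∑ i : Fin n, ((if f (upper i) < f q ∨ f (upper i) = f q ∧ upper i < q then 1 else 0) +
        if f (upper i).rev < f q ∨ f (upper i).rev = f q ∧ (upper i).rev < q then 1 else 0) := by
  rw [sort_inv_apply, card_filter, sum_eq_sum_upper]

/-! ### The diagonal element: words with one marked pair -/

section MarkedWord

/-- The word with a single positive and a single negative letter. -/
def markedWord (c : Fin (2 * n)) (a : Fin (2 * n)) : ℤ :=
  if a = c then 1 else if a = c.rev then -1 else 0

theorem rev_ne_self (c : Fin (2 * n)) : c.rev ≠ c := by
  simp only [ne_eq, Fin.ext_iff, Fin.val_rev]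
  omega

theorem markedWord_self (c : Fin (2 * n)) : markedWord c c = 1 := if_pos rfl

theorem markedWord_rev_self (c : Fin (2 * n)) : markedWord c c.rev = -1 := by
  rw [markedWord, if_neg (rev_ne_self c), if_pos rfl]

theorem markedWord_of_ne {c a : Fin (2 * n)} (h1 : a ≠ c) (h2 : a ≠ c.rev) :
    markedWord c a = 0 := by
  rw [markedWord, if_neg h1, if_neg h2]

theorem markedWord_rev (c a : Fin (2 * n)) : markedWord c a.rev = -markedWord c a := by
  by_cases h1 : a = c
  · rw [h1, markedWord_self, markedWord_rev_self]
  by_cases h2 : a = c.rev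
  · rw [h2, markedWord_rev_self, Fin.rev_rev, markedWord_self, neg_neg]
  · rw [markedWord_of_ne h1 h2, markedWord_of_ne, neg_zero]
    · rwa [ne_eq, Fin.rev_eq_iff]
    · rwa [ne_eq, Fin.rev_inj]

theorem isOddWord_markedWord (c : Fin (2 * n)) : IsOddWord (markedWord c) := fun a b h => by
  rw [markedWord_rev, markedWord_rev]
  exact neg_lt_neg h

theorem markedWord_comp (c : Fin (2 * n)) {w : Equiv.Perm (Fin (2 * n))}
    (hw : w ∈ signedPerm (2 * n)) : markedWord c ∘ w = markedWord (w⁻¹ c) := by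
  ext a
  simp only [Function.comp_apply, markedWord]
  rw [← inv_mem hw]
  simp only [Equiv.Perm.eq_inv_iff_eq]

theorem markedWord_injective :
    Function.Injective (markedWord : Fin (2 * n) → Fin (2 * n) → ℤ) := fun c c' h => by
  have := congrFun h c
  rw [markedWord_self, markedWord] at this
  split_ifs at this with h1
  · exact h1
  · omega

theorem monotone_markedWord_iff {c : Fin (2 * n)} :
    Monotone (markedWord c) ↔ (c : ℕ) + 1 = 2 * n := by
  constructor
  · intro h
    by_contra hne
    have h1 := h (show c ≤ ⟨2 * n - 1, by omega⟩ from Fin.le_def.2 (by simp only; omega))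
    rw [markedWord_self, markedWord] at h1
    split_ifs at h1 with h2 <;> first | omega | skip
    rw [← h2] at hne
    simp only at hne
    omega
  · intro h a b hab
    have hr : (c.rev : ℕ) = 0 := by rw [Fin.val_rev]; omega
    rw [Fin.le_def] at hab
    simp only [markedWord, Fin.ext_iff, hr]
    split_ifs <;> omega

theorem ties_markedWord {c : Fin (2 * n)} (hc : (c : ℕ) + 1 = 2 * n) :
    ties (markedWord c) = ({i | (i : ℕ) ≠ 0} : Finset (Fin n)) := by
  ext i
  have hr : (c.rev : ℕ) = 0 := by rw [Fin.val_rev]; omega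
  rw [mem_ties, mem_filter]
  simp only [markedWord, Fin.ext_iff, hr, stepLeft, stepRight, mem_univ, true_and]
  have hi := i.2
  split_ifs <;> grind

theorem ascendingSum_ne_zero_eq_sum (hn : n ≠ 0) :
    ascendingSum {i : Fin n | (i : ℕ) ≠ 0} =
      ∑ c : Fin (2 * n), MonoidAlgebra.of ℚ _ (Tuple.sort (markedWord c)) := by
  classical
  rw [← sum_image (f := fun f => MonoidAlgebra.of ℚ _ (Tuple.sort f))
    markedWord_injective.injOn, sum_sort]
  · rw [filter_image, sum_image markedWord_injective.injOn]
    simp only [monotone_markedWord_iff]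
    rw [sum_eq_single ⟨2 * n - 1, by omega⟩, ties_markedWord]
    · simp only; omega
    · intro c hc hne
      rw [mem_filter] at hc
      exact (hne (Fin.ext (by simp only; omega))).elim
    · intro h
      simp only [mem_filter, mem_univ, true_and] at h
      omega
  · intro f hf
    obtain ⟨c, -, rfl⟩ := mem_image.1 hf
    exact isOddWord_markedWord c
  · intro f hf w hw
    obtain ⟨c, -, rfl⟩ := mem_image.1 hf
    rw [markedWord_comp c hw]
    exact mem_image_of_mem _ (mem_univ _)

theorem sum_ite_lt_add_one (k : Fin n) :
    ∑ i : Fin n, ((if i < k then 1 else 0) + 1) = n + (k : ℕ) := by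
  rw [sum_add_distrib, ← card_filter, sum_const, smul_eq_mul, mul_one, card_univ, Fintype.card_fin,
    add_comm]
  congr 1
  rw [← Fin.card_Iio]
  congr 1
  ext
  simp

/-- Sorting sends the marked pair to the two ends. If `i < k`, both of its positions preceded `upper
k` and only one still does; otherwise the count is unchanged. -/
theorem sort_markedWord_inv_apply {c : Fin (2 * n)} {i k : Fin n} (hik : i ≠ k)
    (hc : c = upper i ∨ c = (upper i).rev) :
    (((Tuple.sort (markedWord c))⁻¹ (upper k) : Fin (2 * n)) : ℕ) =
      n + (k - if i < k then 1 else 0) := by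
  have hq : markedWord c (upper k) = 0 := by
    have h1 := upper_injective.ne hik.symm
    have h2 := upper_ne_rev_upper k i
    rcases hc with rfl | rfl
    · exact markedWord_of_ne h1 h2
    · exact markedWord_of_ne h2 (by rwa [Fin.rev_rev])
  rw [sort_inv_apply_eq_sum, hq]
  have hj : ∀ j : Fin n, ((if markedWord c (upper j) < 0 ∨ markedWord c (upper j) = 0 ∧
      upper j < upper k then 1 else 0) + if markedWord c (upper j).rev < 0 ∨
      markedWord c (upper j).rev = 0 ∧ (upper j).rev < upper k then 1 else 0) +
      (if j = i then (if i < k then 1 else 0) else 0) = (if j < k then 1 else 0) + 1 := by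
    intro j
    rw [markedWord_rev]
    by_cases hji : j = i
    · subst hji
      rcases hc with rfl | rfl
      · simp [markedWord_self, add_comm]
      · have : markedWord (upper j).rev (upper j) = -1 := by
          have := markedWord_rev_self (upper j).rev
          rwa [Fin.rev_rev] at this
        simp [this, add_comm]
    · have h0 : markedWord c (upper j) = 0 := by
        have h1 := upper_injective.ne hji
        have h2 := upper_ne_rev_upper j i
        rcases hc with rfl | rfl
        · exact markedWord_of_ne h1 h2
        · exact markedWord_of_ne h2 (by rwa [Fin.rev_rev])
      have h3 : (upper j).rev < upper k := by
        simp only [upper, Fin.lt_def, Fin.val_rev]; omega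
      have h4 : upper j < upper k ↔ j < k := by
        simp only [upper, Fin.lt_def]; omega
      simp [h0, h3, h4, hji]
  have hsum := sum_congr rfl fun j (_ : j ∈ (univ : Finset (Fin n))) => hj j
  rw [sum_add_distrib, sum_ite_eq' univ i, if_pos (mem_univ i), sum_ite_lt_add_one] at hsum
  split_ifs at hsum ⊢ with h
  · have := Fin.lt_def.1 h
    omega
  · omega

theorem natCast_mul_choose_pred (k d : ℕ) :
    (k : ℚ) * ((k - 1).choose d : ℚ) = (k - d) * (k.choose d : ℚ) := by
  cases k with
  | zero => cases d <;> simp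
  | succ k =>
    rw [Nat.add_sub_cancel]
    rcases Nat.lt_or_ge (k + 1) d with h | h
    · rw [Nat.choose_eq_zero_of_lt h, Nat.choose_eq_zero_of_lt (Nat.lt_of_succ_lt h)]
      simp
    · have := congrArg (Nat.cast : ℕ → ℚ) (Nat.choose_mul_succ_eq k d)
      push_cast [Nat.cast_sub h] at this ⊢
      linarith

/-- The binomial vectors are eigenvectors of the element `ascendingSum J` with `J` the set of all
steps except the outermost one. -/
theorem permRep_ascendingSum_ne_zero_binomVec (hn : n ≠ 0) (d : ℕ) :
    permRep _ (ascendingSum {i : Fin n | (i : ℕ) ≠ 0}) (binomVec n d) =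
      (2 * ((n : ℚ) - 1 - d)) • binomVec n d := by
  refine odd_ext (permRep_ascendingSum_odd _ (binomVec_rev d)) (fun a => ?_) fun k => ?_
  · rw [Pi.smul_apply, Pi.smul_apply, binomVec_rev, smul_neg]
  rw [ascendingSum_ne_zero_eq_sum hn]
  simp only [map_sum, LinearMap.sum_apply, Finset.sum_apply, permRep_of_apply]
  rw [sum_eq_sum_upper, ← add_sum_erase _ _ (mem_univ k)]
  have hk1 : (((Tuple.sort (markedWord (upper k)))⁻¹ (upper k) : Fin (2 * n)) : ℕ) =
      n + (n - 1) := by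
    rw [sort_inv_apply]
    have : ({a | markedWord (upper k) a < markedWord (upper k) (upper k) ∨
        markedWord (upper k) a = markedWord (upper k) (upper k) ∧ a < upper k} :
        Finset (Fin (2 * n))) = univ.erase (upper k) := by
      ext a
      simp only [mem_filter, mem_univ, true_and, mem_erase, markedWord_self, and_true]
      simp only [markedWord]
      split_ifs with h <;> simp [h]
    rw [this, card_erase_of_mem (mem_univ _), card_univ, Fintype.card_fin]
    omega
  have hk2 : (((Tuple.sort (markedWord (upper k).rev))⁻¹ (upper k) : Fin (2 * n)) : ℕ) +
      (n - 1) + 1 = n := by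
    have h1 : markedWord (upper k).rev (upper k) = -1 := by
      have := markedWord_rev_self (upper k).rev
      rwa [Fin.rev_rev] at this
    rw [sort_inv_apply, h1]
    have : ({a | markedWord (upper k).rev a < -1 ∨
        markedWord (upper k).rev a = -1 ∧ a < upper k} :
        Finset (Fin (2 * n))) = ∅ := by
      ext a
      simp only [mem_filter, mem_univ, true_and, notMem_empty, iff_false]
      simp only [markedWord, Fin.rev_rev]
      split_ifs with h h'
      · simp
      · simp [h']
      · simp
    rw [this, card_empty]
    omega
  -- Marking `upper k` or its mirror sends it to the last or the first position, where an odd vector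
  -- takes opposite values.
  rw [binomVec_of_le hk1, binomVec_of_lt hk2, add_neg_cancel, zero_add]
  have hi : ∀ i ∈ univ.erase k,
      binomVec n d ((Tuple.sort (markedWord (upper i)))⁻¹ (upper k)) +
        binomVec n d ((Tuple.sort (markedWord (upper i).rev))⁻¹ (upper k)) =
      if i < k then 2 * (((k : ℕ) - 1).choose d : ℚ) else 2 * ((k : ℕ).choose d : ℚ) := by
    intro i hi
    have hik := (mem_erase.1 hi).1
    rw [binomVec_of_le (sort_markedWord_inv_apply hik (Or.inl rfl)),
      binomVec_of_le (sort_markedWord_inv_apply hik (Or.inr rfl)), ← two_mul]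
    split_ifs <;> simp
  rw [sum_congr rfl hi, sum_ite, sum_const, sum_const]
  have hc1 : #{i ∈ univ.erase k | i < k} = k := by
    rw [← Fin.card_Iio]
    congr 1
    ext i
    simp only [mem_filter, mem_erase, mem_univ, and_true, mem_Iio, ne_eq]
    exact ⟨fun h => h.2, fun h => ⟨h.ne, h⟩⟩
  have hc2 : #{i ∈ univ.erase k | ¬ i < k} = n - 1 - k := by
    rw [← Fin.card_Ioi]
    congr 1
    ext i
    simp only [mem_filter, mem_erase, mem_univ, and_true, mem_Ioi, ne_eq, not_lt]
    exact ⟨fun h => lt_of_le_of_ne h.2 (Ne.symm h.1), fun h => ⟨h.ne', h.le⟩⟩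
  rw [hc1, hc2, Pi.smul_apply, binomVec_upper]
  simp only [nsmul_eq_mul, smul_eq_mul]
  rw [Nat.cast_sub (by omega), Nat.cast_sub (by omega)]
  push_cast
  -- The sum `2k C(k-1,d) + 2(n-1-k) C(k,d)` collapses through `k C(k-1,d) = (k-d) C(k,d)`.
  linear_combination 2 * natCast_mul_choose_pred k d

end MarkedWord

end Representation

section Representation

variable {n : ℕ}

/-! ### The triangular element: sign words and a generating function -/

section SignWord

/-- The odd word with letters `false` and `true` and the given values in the upper half. -/
def signWord (ε : Fin n → Bool) (a : Fin (2 * n)) : Bool :=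
  if h : n ≤ a then ε ⟨a - n, by omega⟩ else !ε ⟨n - 1 - a, by omega⟩

theorem signWord_upper (ε : Fin n → Bool) (i : Fin n) : signWord ε (upper i) = ε i := by
  rw [signWord, dif_pos (by simp [upper])]
  congr 1
  simp [upper]

theorem signWord_rev_upper (ε : Fin n → Bool) (i : Fin n) :
    signWord ε (upper i).rev = !ε i := by
  have h : ¬ n ≤ ((upper i).rev : ℕ) := by simp only [upper, Fin.val_rev]; omega
  rw [signWord, dif_neg h]
  congr 2
  simp only [upper, Fin.val_rev, Fin.ext_iff]
  omega

theorem signWord_rev (ε : Fin n → Bool) (a : Fin (2 * n)) :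
    signWord ε a.rev = !signWord ε a := by
  obtain ⟨i, rfl | rfl⟩ := eq_upper_or_eq_rev a
  · rw [signWord_rev_upper, signWord_upper]
  · rw [Fin.rev_rev, signWord_rev_upper, signWord_upper, Bool.not_not]

theorem signWord_injective :
    Function.Injective (signWord : (Fin n → Bool) → Fin (2 * n) → Bool) := fun ε ε' h => by
  ext i
  rw [← signWord_upper ε, h, signWord_upper]

theorem isOddWord_signWord (ε : Fin n → Bool) : IsOddWord (signWord ε) := fun a b h => by
  rw [signWord_rev, signWord_rev]
  revert h
  cases signWord ε a <;> cases signWord ε b <;> simp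

theorem signWord_comp (ε : Fin n → Bool) {w : Equiv.Perm (Fin (2 * n))}
    (hw : w ∈ signedPerm (2 * n)) :
    signWord ε ∘ w = signWord (signWord ε ∘ w ∘ upper) := by
  ext a
  obtain ⟨i, rfl | rfl⟩ := eq_upper_or_eq_rev a
  · rw [signWord_upper]; rfl
  · rw [signWord_rev_upper, Function.comp_apply, hw, signWord_rev]; rfl

theorem monotone_signWord_iff {ε : Fin n → Bool} :
    Monotone (signWord ε) ↔ ε = fun _ => true := by
  constructor
  · intro h
    ext i
    have h1 := h (show (upper i).rev ≤ upper i by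
      simp only [upper, Fin.le_def, Fin.val_rev]; omega)
    rw [signWord_upper, signWord_rev_upper] at h1
    revert h1
    cases ε i <;> simp
  · rintro rfl a b hab
    rw [Fin.le_def] at hab
    simp only [signWord]
    split_ifs <;> first | omega | simp

theorem ties_signWord :
    ties (signWord fun _ : Fin n => true) = ({i | (i : ℕ) + 1 ≠ n} : Finset (Fin n)) := by
  ext i
  rw [mem_ties, mem_filter]
  have h1 : (stepLeft i : ℕ) = i := rfl
  have h2 : (stepRight i : ℕ) = i + 1 := rfl
  rw [signWord, dif_neg (by omega), signWord]
  split_ifs with h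
  · simp only [Bool.not_true, Bool.false_eq_true, mem_univ, true_and, ne_eq, false_iff, not_not]
    omega
  · simp only [Bool.not_true, mem_univ, true_and, ne_eq, true_iff]
    omega

theorem ascendingSum_ne_last_eq_sum :
    ascendingSum {i : Fin n | (i : ℕ) + 1 ≠ n} =
      ∑ ε : Fin n → Bool, MonoidAlgebra.of ℚ _ (Tuple.sort (signWord ε)) := by
  classical
  rw [← sum_image (f := fun f => MonoidAlgebra.of ℚ _ (Tuple.sort f))
    signWord_injective.injOn, sum_sort]
  · rw [filter_image, sum_image signWord_injective.injOn]
    simp only [monotone_signWord_iff]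
    rw [sum_eq_single fun _ => true, ties_signWord]
    · intro c hc hne
      exact (hne (mem_filter.1 hc).2).elim
    · simp
  · intro f hf
    obtain ⟨c, -, rfl⟩ := mem_image.1 hf
    exact isOddWord_signWord c
  · intro f hf w hw
    obtain ⟨c, -, rfl⟩ := mem_image.1 hf
    rw [signWord_comp c hw]
    exact mem_image_of_mem _ (mem_univ _)

/-- The number of negative letters of a sign word beyond a given position. -/
def numNegAbove (ε : Fin n → Bool) (k : Fin n) : ℕ := #{i | k < i ∧ ε i = false}

theorem sum_ite_lt (k : Fin n) : ∑ i : Fin n, (if i < k then 1 else 0) = (k : ℕ) := by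
  have := sum_ite_lt_add_one k
  rw [sum_add_distrib] at this
  simp at this ⊢
  omega

theorem numPosAbove (ε : Fin n → Bool) (k : Fin n) :
    #{i | k < i ∧ ε i = true} + numNegAbove ε k + k + 1 = n := by
  have h1 : #{i | k < i ∧ ε i = true} + numNegAbove ε k = n - 1 - k := by
    rw [numNegAbove, ← Fin.card_Ioi, ← card_union_of_disjoint]
    · congr 1
      ext i
      simp only [mem_union, mem_filter, mem_univ, true_and, mem_Ioi]
      cases ε i <;> simp
    · rw [disjoint_filter]
      rintro i - ⟨-, h⟩ ⟨-, h'⟩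
      simp [h] at h'
  omega

theorem rev_upper_lt_upper (j k : Fin n) : (upper j).rev < upper k := by
  simp only [upper, Fin.lt_def, Fin.val_rev]; omega

theorem upper_lt_upper {j k : Fin n} : upper j < upper k ↔ j < k := by
  simp only [upper, Fin.lt_def]; omega

/-- All `n` letters `false` come first. Among the letters `true`, each pair `j < k` contributes
exactly one ahead of `upper k`, and a pair `j > k` contributes its mirror position precisely when `ε
j` is `false`. -/
theorem sort_signWord_inv_apply_of_true {ε : Fin n → Bool} {k : Fin n} (hk : ε k = true) :
    (((Tuple.sort (signWord ε))⁻¹ (upper k) : Fin (2 * n)) : ℕ) =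
      n + (k + numNegAbove ε k) := by
  rw [sort_inv_apply_eq_sum, numNegAbove, card_filter]
  have hj : ∀ j : Fin n, ((if signWord ε (upper j) < signWord ε (upper k) ∨
      signWord ε (upper j) = signWord ε (upper k) ∧ upper j < upper k then 1 else 0) +
      if signWord ε (upper j).rev < signWord ε (upper k) ∨
      signWord ε (upper j).rev = signWord ε (upper k) ∧ (upper j).rev < upper k then 1 else 0) =
      ((if j < k then 1 else 0) + 1) + if k < j ∧ ε j = false then 1 else 0 := by
    intro j
    simp only [signWord_upper, signWord_rev_upper, hk, rev_upper_lt_upper, upper_lt_upper]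
    rcases lt_trichotomy j k with h | rfl | h
    · cases ε j <;> simp [h, h.not_gt]
    · simp [hk]
    · cases ε j <;> simp [h, h.not_gt]
  rw [sum_congr rfl fun j _ => hj j, sum_add_distrib, sum_ite_lt_add_one, add_assoc]

theorem sort_signWord_inv_apply_of_false {ε : Fin n → Bool} {k : Fin n} (hk : ε k = false) :
    (((Tuple.sort (signWord ε))⁻¹ (upper k) : Fin (2 * n)) : ℕ) + numNegAbove ε k + 1 = n := by
  have h0 : (((Tuple.sort (signWord ε))⁻¹ (upper k) : Fin (2 * n)) : ℕ) =
      #{i | k < i ∧ ε i = true} + k := by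
    rw [sort_inv_apply_eq_sum, card_filter]
    have hj : ∀ j : Fin n, ((if signWord ε (upper j) < signWord ε (upper k) ∨
        signWord ε (upper j) = signWord ε (upper k) ∧ upper j < upper k then 1 else 0) +
        if signWord ε (upper j).rev < signWord ε (upper k) ∨
        signWord ε (upper j).rev = signWord ε (upper k) ∧ (upper j).rev < upper k then 1 else 0) =
        (if k < j ∧ ε j = true then 1 else 0) + (if j < k then 1 else 0) := by
      intro j
      simp only [signWord_upper, signWord_rev_upper, hk, rev_upper_lt_upper, upper_lt_upper]
      rcases lt_trichotomy j k with h | rfl | h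
      · cases ε j <;> simp [h, h.not_gt]
      · simp [hk]
      · cases ε j <;> simp [h, h.not_gt]
    rw [sum_congr rfl fun j _ => hj j, sum_add_distrib, sum_ite_lt]
  have := numPosAbove ε k
  omega

open Polynomial in
/-- The coefficients of the action of the full sign shuffle in the binomial basis. -/
noncomputable def binomCoeff (n i d : ℕ) : ℚ :=
  (1 - (-1) ^ i) * (X ^ i * (X + C 2) ^ (n - 1 - i) : ℚ[X]).coeff d

theorem binomCoeff_of_lt {n i d : ℕ} (hi : d < i) : binomCoeff n i d = 0 := by
  rw [binomCoeff, Polynomial.coeff_X_pow_mul', if_neg (by omega), mul_zero]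

theorem binomCoeff_nonneg (n i d : ℕ) : 0 ≤ binomCoeff n i d := by
  rw [binomCoeff, Polynomial.coeff_X_pow_mul']
  refine mul_nonneg ?_ ?_
  · rcases neg_one_pow_eq_or ℚ i with h | h <;> rw [h] <;> norm_num
  · split_ifs
    · rw [Polynomial.coeff_X_add_C_pow]
      positivity
    · exact le_rfl

theorem binomCoeff_pos {n i d : ℕ} (hi : Odd i) (hid : i ≤ d) (hdn : d + 1 ≤ n) :
    0 < binomCoeff n i d := by
  rw [binomCoeff, Polynomial.coeff_X_pow_mul', hi.neg_one_pow, if_pos hid,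
    Polynomial.coeff_X_add_C_pow]
  have : 0 < (n - 1 - i).choose (d - i) := Nat.choose_pos (by omega)
  positivity

-- Since `C(m,d)` is the coefficient of `X ^ d` in `(1 + X) ^ m`, this encodes the action on every
-- binomial vector at `upper k`. The sum over signs factors over positions into `((1 + X)^k - 1) *
-- 2^k * (X + 2)^(n-1-k)`.
open Polynomial in
theorem sum_signed_one_add_X_pow (k : Fin n) :
    ∑ ε : Fin n → Bool, (if ε k = true then (1 + X : ℚ[X]) ^ ((k : ℕ) + numNegAbove ε k) else
      -(1 + X) ^ numNegAbove ε k) =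
      ∑ i ∈ range n, C (((k : ℕ).choose i : ℚ) * (1 - (-1) ^ i)) *
        (X ^ i * (X + C 2) ^ (n - 1 - i)) := by
  let φ : Fin n → Bool → ℚ[X] := fun i b =>
    if i = k then (if b = true then (1 + X) ^ (k : ℕ) else -1)
    else if k < i ∧ b = false then 1 + X else 1
  have h1 : ∀ ε : Fin n → Bool,
      (if ε k = true then (1 + X : ℚ[X]) ^ ((k : ℕ) + numNegAbove ε k) else
        -(1 + X) ^ numNegAbove ε k) = ∏ i, φ i (ε i) := by
    intro ε
    have h2 : ∏ i ∈ univ.erase k, φ i (ε i) = (1 + X : ℚ[X]) ^ numNegAbove ε k := by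
      rw [prod_congr rfl (g := fun i => if k < i ∧ ε i = false then (1 + X : ℚ[X]) else 1),
        prod_ite, prod_const, prod_const_one, mul_one, numNegAbove]
      · congr 2
        ext i
        simp only [mem_filter, mem_erase, mem_univ, and_true, true_and, ne_eq]
        exact ⟨fun h => h.2, fun h => ⟨h.1.ne', h⟩⟩
      · intro i hi
        simp only [φ, if_neg (mem_erase.1 hi).1]
    rw [← mul_prod_erase _ _ (mem_univ k), h2]
    simp only [φ, if_true]
    split_ifs
    · rw [pow_add]
    · rw [neg_one_mul]
  have h3 : ∏ i : Fin n, ∑ b : Bool, φ i b =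
      ((1 + X) ^ (k : ℕ) - 1) * (2 ^ (k : ℕ) * (X + C 2) ^ (n - 1 - (k : ℕ))) := by
    rw [← mul_prod_erase _ _ (mem_univ k)]
    congr 1
    · simp only [Fintype.sum_bool, φ, if_true]
      simp [sub_eq_add_neg]
    · rw [prod_congr rfl (g := fun i => if i < k then (2 : ℚ[X]) else X + C 2), prod_ite,
        prod_const, prod_const]
      · congr 2
        · rw [← Fin.card_Iio]
          congr 1
          ext i
          simp only [mem_filter, mem_erase, mem_univ, and_true, mem_Iio, ne_eq]
          exact ⟨fun h => h.2, fun h => ⟨h.ne, h⟩⟩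
        · rw [← Fin.card_Ioi]
          congr 1
          ext i
          simp only [mem_filter, mem_erase, mem_univ, and_true, mem_Ioi, ne_eq, not_lt]
          exact ⟨fun h => lt_of_le_of_ne h.2 (Ne.symm h.1), fun h => ⟨h.ne', h.le⟩⟩
      · intro i hi
        have hik := (mem_erase.1 hi).1
        simp only [Fintype.sum_bool, φ, if_neg hik]
        rcases lt_or_gt_of_ne hik with h | h
        · simp [h, h.not_gt]
          norm_num
        · simp [h, h.not_gt]
          rw [show (C 2 : ℚ[X]) = 2 from rfl]
          ring
  have h4 : ((1 + X : ℚ[X]) ^ (k : ℕ) - 1) * 2 ^ (k : ℕ) =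
      ∑ i ∈ range (k + 1), C (((k : ℕ).choose i : ℚ) * (1 - (-1) ^ i)) *
        (X ^ i * (X + C 2) ^ ((k : ℕ) - i)) := by
    -- Writing `2(1 + X) = X + (X + 2)` and `2 = -X + (X + 2)` makes the values `C(k,i)` of the
    -- binomial vectors appear; even `i` cancel.
    have h5 : ((1 + X : ℚ[X]) ^ (k : ℕ) - 1) * 2 ^ (k : ℕ) =
        (X + (X + C 2)) ^ (k : ℕ) - (-X + (X + C 2)) ^ (k : ℕ) := by
      rw [show (C 2 : ℚ[X]) = 2 from rfl, sub_mul, ← mul_pow, one_mul]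
      ring
    rw [h5, add_pow, add_pow, ← sum_sub_distrib]
    refine sum_congr rfl fun i _ => ?_
    simp only [map_mul, map_sub, map_pow, map_neg, map_one, map_natCast]
    rw [neg_pow (X : ℚ[X]) i]
    ring
  rw [sum_congr rfl fun ε _ => h1 ε, ← Fintype.piFinset_univ, ← prod_univ_sum, h3, ← mul_assoc, h4,
    sum_mul]
  have h6 : range (k + 1) ⊆ range n := range_mono (by omega)
  rw [← sum_subset h6]
  · refine sum_congr rfl fun i hi => ?_
    rw [mem_range] at hi
    rw [mul_assoc, mul_assoc, ← pow_add]
    congr 3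
    omega
  · intro i _ hi
    rw [mem_range, not_lt] at hi
    rw [Nat.choose_eq_zero_of_lt (by omega)]
    simp

theorem permRep_ascendingSum_ne_last_binomVec (d : ℕ) :
    permRep _ (ascendingSum {i : Fin n | (i : ℕ) + 1 ≠ n}) (binomVec n d) =
      ∑ i ∈ range n, binomCoeff n i d • binomVec n i := by
  refine odd_ext (permRep_ascendingSum_odd _ (binomVec_rev d)) (fun a => ?_) fun k => ?_
  · simp only [Finset.sum_apply, Pi.smul_apply, binomVec_rev, smul_neg, sum_neg_distrib]
  rw [ascendingSum_ne_last_eq_sum]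
  simp only [map_sum, LinearMap.sum_apply, Finset.sum_apply, permRep_of_apply, Pi.smul_apply,
    binomVec_upper, smul_eq_mul]
  have h := congrArg (fun p => Polynomial.coeff p d) (sum_signed_one_add_X_pow k)
  simp only [Polynomial.finsetSum_coeff, Polynomial.coeff_C_mul] at h
  rw [sum_congr rfl fun i _ => (show binomCoeff n i d * ((k : ℕ).choose i : ℚ) = _ by
    rw [binomCoeff, mul_comm, ← mul_assoc]), ← h]
  refine sum_congr rfl fun ε _ => ?_
  cases hk : ε k
  · rw [binomVec_of_lt (sort_signWord_inv_apply_of_false hk)]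
    simp [Polynomial.coeff_one_add_X_pow]
  · rw [binomVec_of_le (sort_signWord_inv_apply_of_true hk)]
    simp [Polynomial.coeff_one_add_X_pow]

end SignWord

/-! ### Nonvanishing powers of the commutator -/

/-- The commutator of the two elements acting triangularly on the binomial vectors. -/
noncomputable def ascendingCommutator (n : ℕ) : MonoidAlgebra ℚ (Equiv.Perm (Fin (2 * n))) :=
  ascendingSum {i | (i : ℕ) ≠ 0} * ascendingSum {i | (i : ℕ) + 1 ≠ n} -
    ascendingSum {i | (i : ℕ) + 1 ≠ n} * ascendingSum {i | (i : ℕ) ≠ 0}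

theorem permRep_ascendingCommutator_binomVec (hn : n ≠ 0) (d : ℕ) :
    permRep _ (ascendingCommutator n) (binomVec n d) =
      ∑ i ∈ range n, (2 * ((d : ℚ) - i) * binomCoeff n i d) • binomVec n i := by
  rw [ascendingCommutator, map_sub, map_mul, map_mul, LinearMap.sub_apply, Module.End.mul_apply,
    Module.End.mul_apply, permRep_ascendingSum_ne_last_binomVec,
    permRep_ascendingSum_ne_zero_binomVec hn, map_sum, map_smul,
    permRep_ascendingSum_ne_last_binomVec, smul_sum, ← sum_sub_distrib]
  refine sum_congr rfl fun i _ => ?_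
  rw [map_smul, permRep_ascendingSum_ne_zero_binomVec hn, smul_smul, smul_smul, ← sub_smul]
  congr 1
  ring

/-- All matrix entries are nonnegative, because `binomCoeff n i d` vanishes where `d - i` is
negative. Hence the positive contribution from `d` to an odd `e < d` cannot cancel. -/
theorem permRep_ascendingCommutator_pos (hn : n ≠ 0) {c : ℕ → ℚ} (hc : ∀ i, 0 ≤ c i) {d e : ℕ}
    (hd : d < n) (hcd : 0 < c d) (he : Odd e) (hed : e < d) :
    ∃ c' : ℕ → ℚ, (∀ i, 0 ≤ c' i) ∧ 0 < c' e ∧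
      permRep _ (ascendingCommutator n) (∑ i ∈ range n, c i • binomVec n i) =
        ∑ i ∈ range n, c' i • binomVec n i := by
  have hnn : ∀ i j, 0 ≤ c j * (2 * ((j : ℚ) - i) * binomCoeff n i j) := by
    intro i j
    rcases Nat.lt_or_ge j i with h | h
    · rw [binomCoeff_of_lt h, mul_zero, mul_zero]
    · have : (0 : ℚ) ≤ j - i := sub_nonneg.2 (Nat.cast_le.2 h)
      have := binomCoeff_nonneg n i j
      have := hc j
      positivity
  refine ⟨fun i => ∑ j ∈ range n, c j * (2 * ((j : ℚ) - i) * binomCoeff n i j),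
    fun i => sum_nonneg fun j _ => hnn i j, ?_, ?_⟩
  · refine sum_pos' (fun j _ => hnn e j) ⟨d, mem_range.2 hd, ?_⟩
    have h1 : (0 : ℚ) < d - e := sub_pos.2 (Nat.cast_lt.2 hed)
    have h2 := binomCoeff_pos (n := n) he hed.le hd
    positivity
  · simp only [map_sum, map_smul, permRep_ascendingCommutator_binomVec hn, smul_sum, sum_smul,
      smul_smul]
    exact sum_comm

/-- Each application moves to the next lower odd index, so `k` applications end exactly at `1`. -/
theorem permRep_ascendingCommutator_pow_pos (hn : n ≠ 0) (k : ℕ) {c : ℕ → ℚ} (hc : ∀ i, 0 ≤ c i)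
    {d : ℕ} (hd : d < n) (hcd : 0 < c d) (hkd : d = 2 * k + 1 ∨ k ≠ 0 ∧ d = 2 * k) :
    ∃ c' : ℕ → ℚ, (∀ i, 0 ≤ c' i) ∧ 0 < c' 1 ∧
      permRep _ (ascendingCommutator n ^ k) (∑ i ∈ range n, c i • binomVec n i) =
        ∑ i ∈ range n, c' i • binomVec n i := by
  induction k generalizing c d with
  | zero =>
    obtain rfl : d = 1 := by omega
    exact ⟨c, hc, hcd, by simp⟩
  | succ k ih =>
    obtain ⟨c₁, h1, h2, h3⟩ := permRep_ascendingCommutator_pos hn hc hd hcd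
      (e := 2 * k + 1) ⟨k, rfl⟩ (by omega)
    obtain ⟨c₂, h4, h5, h6⟩ := ih h1 (by omega) h2 (Or.inl rfl)
    refine ⟨c₂, h4, h5, ?_⟩
    rw [pow_succ, map_mul, Module.End.mul_apply, h3, h6]

theorem ascendingCommutator_pow_ne_zero {k : ℕ} (hkn : 2 * k < n) :
    ascendingCommutator n ^ k ≠ 0 := by
  rcases eq_or_ne k 0 with rfl | hk
  · rw [pow_zero]
    exact one_ne_zero
  intro h
  obtain ⟨c', h1, h2, h3⟩ := permRep_ascendingCommutator_pow_pos (n := n) (by omega) k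
    (c := fun _ => 1) (fun _ => zero_le_one) hkn zero_lt_one (Or.inr ⟨hk, rfl⟩)
  rw [h, map_zero, LinearMap.zero_apply] at h3
  -- At this point the vector of index `1` has value `1` and the others are nonnegative.
  have h4 := congrFun h3 (upper ⟨1, by omega⟩)
  simp only [Finset.sum_apply, Pi.smul_apply, binomVec_upper, smul_eq_mul, Pi.zero_apply] at h4
  have h5 : (0 : ℚ) < ∑ i ∈ range n, c' i * ((1 : ℕ).choose i : ℚ) :=
    sum_pos' (fun i _ => mul_nonneg (h1 i) (Nat.cast_nonneg _))
      ⟨1, mem_range.2 (by omega), by simpa using h2⟩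
  exact h5.ne h4

end Representation

/-! ### Simple signed permutations and the Coxeter relations of type `B` -/

section SimplePerm

variable {n : ℕ}

/-- The map exchanging `i` and `i + 1`, and their mirror images. -/
def simpleFun (i : Fin n) (p : Fin (2 * n)) : Fin (2 * n) :=
  -- For `i = n - 1` the mirrored pair is the pair itself, and the map swaps the two central
  -- positions.
  ⟨if (p : ℕ) = i then i + 1 else if (p : ℕ) = i + 1 then i else
    if (p : ℕ) = 2 * n - 1 - i then 2 * n - 2 - i else
    if (p : ℕ) = 2 * n - 2 - i then 2 * n - 1 - i else p, by split_ifs <;> omega⟩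

theorem simpleFun_involutive (i : Fin n) : Function.Involutive (simpleFun i) := fun p => by
  have := i.2
  ext
  simp only [simpleFun]
  grind

/-- The simple signed permutations. -/
def simplePerm (i : Fin n) : Equiv.Perm (Fin (2 * n)) := (simpleFun_involutive i).toPerm

theorem val_simplePerm (i : Fin n) (p : Fin (2 * n)) :
    (simplePerm i p : ℕ) = if (p : ℕ) = i then (i : ℕ) + 1 else if (p : ℕ) = i + 1 then (i : ℕ) else
    if (p : ℕ) = 2 * n - 1 - i then 2 * n - 2 - i else
    if (p : ℕ) = 2 * n - 2 - i then 2 * n - 1 - i else (p : ℕ) := rfl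

theorem simplePerm_mul_self (i : Fin n) : simplePerm i * simplePerm i = 1 :=
  Equiv.ext (simpleFun_involutive i)

theorem simplePerm_apply_self (i : Fin n) (p : Fin (2 * n)) :
    simplePerm i (simplePerm i p) = p := simpleFun_involutive i p

theorem simplePerm_mem (i : Fin n) : simplePerm i ∈ signedPerm (2 * n) := fun p => by
  have := i.2
  have := p.2
  ext
  rw [val_simplePerm, Fin.val_rev, Fin.val_rev, val_simplePerm]
  grind

theorem simplePerm_stepLeft (i : Fin n) : simplePerm i (stepLeft i) = stepRight i := by
  ext
  rw [val_simplePerm, stepLeft, stepRight]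
  simp

theorem simplePerm_stepRight (i : Fin n) : simplePerm i (stepRight i) = stepLeft i := by
  ext
  rw [val_simplePerm, stepLeft, stepRight]
  simp

theorem rev_simplePerm (i : Fin n) (p : Fin (2 * n)) :
    simplePerm i p.rev = (simplePerm i p).rev := simplePerm_mem i p

theorem val_simplePerm_cases (i : Fin n) (p : Fin (2 * n)) :
    ((p : ℕ) = i ∧ (simplePerm i p : ℕ) = i + 1) ∨ ((p : ℕ) = i + 1 ∧ (simplePerm i p : ℕ) = i) ∨
    ((p : ℕ) = 2 * n - 1 - i ∧ (simplePerm i p : ℕ) = 2 * n - 2 - i) ∨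
    ((p : ℕ) = 2 * n - 2 - i ∧ (simplePerm i p : ℕ) = 2 * n - 1 - i) ∨
    ((p : ℕ) ≠ i ∧ (p : ℕ) ≠ i + 1 ∧ (p : ℕ) ≠ 2 * n - 1 - i ∧ (p : ℕ) ≠ 2 * n - 2 - i ∧
      (simplePerm i p : ℕ) = p) := by
  rw [val_simplePerm]
  split_ifs <;> omega

theorem simplePerm_of_ne {i : Fin n} {p : Fin (2 * n)} (h1 : (p : ℕ) ≠ i) (h2 : (p : ℕ) ≠ i + 1)
    (h3 : (p : ℕ) ≠ 2 * n - 1 - i) (h4 : (p : ℕ) ≠ 2 * n - 2 - i) : simplePerm i p = p := by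
  ext
  rw [val_simplePerm, if_neg h1, if_neg h2, if_neg h3, if_neg h4]

theorem simplePerm_cases (i : Fin n) (p : Fin (2 * n)) :
    p = stepLeft i ∨ p = stepRight i ∨ p = (stepLeft i).rev ∨ p = (stepRight i).rev ∨
      simplePerm i p = p := by
  simp only [Fin.ext_iff, Fin.val_rev, stepLeft, stepRight]
  rcases val_simplePerm_cases i p with h | h | h | h | h <;> omega

theorem simplePerm_stepLeft_of_lt {i j : Fin n} (hij : (i : ℕ) + 1 < j) :
    simplePerm i (stepLeft j) = stepLeft j := by
  apply simplePerm_of_ne <;> simp only [stepLeft] <;> omega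

theorem simplePerm_stepRight_of_lt {i j : Fin n} (hij : (i : ℕ) + 1 < j) :
    simplePerm i (stepRight j) = stepRight j := by
  apply simplePerm_of_ne <;> simp only [stepRight] <;> omega

theorem simplePerm_stepLeft_of_gt {i j : Fin n} (hij : (i : ℕ) < j) :
    simplePerm j (stepLeft i) = stepLeft i := by
  apply simplePerm_of_ne <;> simp only [stepLeft] <;> omega

theorem simplePerm_stepRight_of_gt {i j : Fin n} (hij : (i : ℕ) + 1 < j) :
    simplePerm j (stepRight i) = stepRight i := by
  apply simplePerm_of_ne <;> simp only [stepRight] <;> omega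

theorem simplePerm_stepRight_of_succ {i j : Fin n} (hij : (i : ℕ) + 1 = j)
    (hj : (j : ℕ) + 1 < n) : simplePerm i (stepRight j) = stepRight j := by
  apply simplePerm_of_ne <;> simp only [stepRight] <;> omega

theorem stepRight_eq_stepLeft {i j : Fin n} (hij : (i : ℕ) + 1 = j) :
    stepRight i = stepLeft j := by
  simp only [stepRight, stepLeft, Fin.ext_iff]
  omega

theorem stepRight_eq_rev {j : Fin n} (hj : (j : ℕ) + 1 = n) : stepRight j = (stepLeft j).rev := by
  simp only [stepRight, stepLeft, Fin.ext_iff, Fin.val_rev]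
  omega

theorem simplePerm_comm {i j : Fin n} (hij : (i : ℕ) + 1 < j) :
    simplePerm i * simplePerm j = simplePerm j * simplePerm i := by
  ext p : 1
  have h1 := simplePerm_stepLeft_of_lt hij
  have h2 := simplePerm_stepRight_of_lt hij
  have h3 := simplePerm_stepLeft_of_gt (Nat.lt_of_succ_lt hij)
  have h4 := simplePerm_stepRight_of_gt hij
  simp only [Equiv.Perm.mul_apply]
  rcases simplePerm_cases j p with rfl | rfl | rfl | rfl | hj
  · simp only [simplePerm_stepLeft, h1, h2]
  · simp only [simplePerm_stepRight, h1, h2]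
  · simp only [rev_simplePerm, simplePerm_stepLeft, h1, h2]
  · simp only [rev_simplePerm, simplePerm_stepRight, h1, h2]
  rcases simplePerm_cases i p with rfl | rfl | rfl | rfl | hi
  · simp only [simplePerm_stepLeft, h3, h4]
  · simp only [simplePerm_stepRight, h3, h4]
  · simp only [rev_simplePerm, simplePerm_stepLeft, h3, h4]
  · simp only [rev_simplePerm, simplePerm_stepRight, h3, h4]
  · rw [hj, hi, hj]

theorem simplePerm_braid {i j : Fin n} (hij : (i : ℕ) + 1 = j) (hj : (j : ℕ) + 1 < n) :
    simplePerm i * simplePerm j * simplePerm i = simplePerm j * simplePerm i * simplePerm j := by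
  ext p : 1
  have h0 := stepRight_eq_stepLeft hij
  have h1 : simplePerm i (stepLeft i) = stepLeft j := by rw [simplePerm_stepLeft, h0]
  have h2 : simplePerm i (stepLeft j) = stepLeft i := by rw [← h0, simplePerm_stepRight]
  have h3 := simplePerm_stepLeft_of_gt (i := i) (j := j) (by omega)
  have h4 := simplePerm_stepRight_of_succ hij hj
  simp only [Equiv.Perm.mul_apply]
  rcases simplePerm_cases j p with rfl | rfl | rfl | rfl | hj
  · simp only [simplePerm_stepLeft, simplePerm_stepRight, h1, h2, h3, h4]
  · simp only [simplePerm_stepRight, h2, h3, h4]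
  · simp only [rev_simplePerm, simplePerm_stepLeft, simplePerm_stepRight, h1, h2, h3, h4]
  · simp only [rev_simplePerm, simplePerm_stepRight, h2, h3, h4]
  rcases simplePerm_cases i p with rfl | rfl | rfl | rfl | hi
  · simp only [simplePerm_stepLeft j, h1, h3, h4]
  · simp only [h0, simplePerm_stepLeft j, simplePerm_stepRight j, h1, h2, h3, h4]
  · simp only [rev_simplePerm, simplePerm_stepLeft j, h1, h3, h4]
  · simp only [rev_simplePerm, h0, simplePerm_stepLeft j, simplePerm_stepRight j, h1, h2, h3, h4]
  · rw [hi, hj, hi, hj]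

theorem simplePerm_braid_four {i j : Fin n} (hij : (i : ℕ) + 1 = j) (hj : (j : ℕ) + 1 = n) :
    simplePerm i * simplePerm j * simplePerm i * simplePerm j =
      simplePerm j * simplePerm i * simplePerm j * simplePerm i := by
  ext p : 1
  have h0 := stepRight_eq_stepLeft hij
  have hr := stepRight_eq_rev hj
  have h1 : simplePerm i (stepLeft i) = stepLeft j := by rw [simplePerm_stepLeft, h0]
  have h2 : simplePerm i (stepLeft j) = stepLeft i := by rw [← h0, simplePerm_stepRight]
  have h3 := simplePerm_stepLeft_of_gt (i := i) (j := j) (by omega)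
  have h4 : simplePerm j (stepLeft j) = (stepLeft j).rev := by rw [simplePerm_stepLeft, hr]
  simp only [Equiv.Perm.mul_apply]
  have hp : p = stepLeft j ∨ p = (stepLeft j).rev ∨ p = stepLeft i ∨ p = (stepLeft i).rev ∨
      (simplePerm i p = p ∧ simplePerm j p = p) := by
    have hi' := simplePerm_cases i p
    have hj' := simplePerm_cases j p
    rw [h0] at hi'
    rw [hr, Fin.rev_rev] at hj'
    tauto
  rcases hp with rfl | rfl | rfl | rfl | ⟨hi, hj⟩
  · simp only [h1, h2, h3, h4, rev_simplePerm]
  · simp only [h1, h2, h3, h4, rev_simplePerm, Fin.rev_rev]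
  · simp only [h1, h2, h3, h4, rev_simplePerm]
  · simp only [h1, h2, h3, h4, rev_simplePerm, Fin.rev_rev]
  · simp only [hi, hj]

theorem isLiftable_simplePerm :
    (CoxeterMatrix.B n).IsLiftable (simplePerm : Fin n → Equiv.Perm (Fin (2 * n))) := by
  have hinv : ∀ i : Fin n, (simplePerm i)⁻¹ = simplePerm i := fun i =>
    inv_eq_of_mul_eq_one_left (simplePerm_mul_self i)
  have key : ∀ i j : Fin n, i < j →
      (simplePerm i * simplePerm j) ^ (CoxeterMatrix.B n).M i j = 1 := by
    intro i j hij
    rw [Fin.lt_def] at hij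
    simp only [CoxeterMatrix.B, Matrix.of_apply]
    rw [if_neg (by rw [Fin.ext_iff]; omega)]
    rcases eq_or_lt_of_le (Nat.succ_le_of_lt hij) with h | h
    · rcases eq_or_lt_of_le (Nat.succ_le_of_lt j.2) with hj | hj
      · rw [if_pos (by omega)]
        have := simplePerm_braid_four h hj
        calc (simplePerm i * simplePerm j) ^ 4
            = (simplePerm i * simplePerm j * simplePerm i * simplePerm j) *
              (simplePerm i * simplePerm j * simplePerm i * simplePerm j) := by
              simp only [pow_succ, pow_zero, one_mul, mul_assoc]
          _ = (simplePerm i * simplePerm j * simplePerm i * simplePerm j) *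
              (simplePerm i * simplePerm j * simplePerm i * simplePerm j)⁻¹ := by
              congr 1
          _ = 1 := mul_inv_cancel _
      · rw [if_neg (by omega), if_pos (by omega)]
        have := simplePerm_braid h hj
        calc (simplePerm i * simplePerm j) ^ 3
            = (simplePerm i * simplePerm j * simplePerm i) *
              (simplePerm j * simplePerm i * simplePerm j) := by
              simp only [pow_succ, pow_zero, one_mul, mul_assoc]
          _ = (simplePerm i * simplePerm j * simplePerm i) *
              (simplePerm i * simplePerm j * simplePerm i)⁻¹ := by
              congr 1
              rw [← this]
              simp only [mul_inv_rev, hinv, mul_assoc]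
          _ = 1 := mul_inv_cancel _
    · rw [if_neg (by omega), if_neg (by omega)]
      have := simplePerm_comm h
      rw [pow_two]
      conv_lhs => arg 2; rw [this]
      rw [mul_assoc, ← mul_assoc (simplePerm j), simplePerm_mul_self, one_mul, simplePerm_mul_self]
  intro i j
  rcases lt_trichotomy i j with h | rfl | h
  · exact key i j h
  · rw [CoxeterMatrix.diagonal, pow_one, simplePerm_mul_self]
  · have := key j i h
    rw [CoxeterMatrix.symmetric, ← inv_inj, inv_one, ← inv_pow, mul_inv_rev, hinv, hinv]
    exact this

/-! ### Weighted inversions -/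

section InvNum

/-- The weighted number of inversions of a permutation. -/
def invNum (g : Equiv.Perm (Fin (2 * n))) : ℕ :=
  -- Inversions come in mirror pairs, except those between a position and its mirror. Weight `2` on
  -- the latter makes every simple step change the total by exactly `2`.
  ∑ p : Fin (2 * n) × Fin (2 * n),
    if p.1 < p.2 ∧ g p.2 < g p.1 then (if p.2 = p.1.rev then 2 else 1) else 0

theorem simplePerm_lt_iff {i : Fin n} {a b : Fin (2 * n)}
    (h1 : ¬ (a = stepLeft i ∧ b = stepRight i)) (h2 : ¬ (a = stepRight i ∧ b = stepLeft i))
    (h3 : ¬ (a = (stepRight i).rev ∧ b = (stepLeft i).rev))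
    (h4 : ¬ (a = (stepLeft i).rev ∧ b = (stepRight i).rev)) :
    simplePerm i a < simplePerm i b ↔ a < b := by
  have := i.2
  have := a.2
  have := b.2
  simp only [Fin.ext_iff, Fin.val_rev, stepLeft, stepRight] at h1 h2 h3 h4
  rw [Fin.lt_def, Fin.lt_def]
  rcases val_simplePerm_cases i a with ha | ha | ha | ha | ha <;>
    rcases val_simplePerm_cases i b with hb | hb | hb | hb | hb <;> omega

theorem invNum_mul_simplePerm_of_lt {g : Equiv.Perm (Fin (2 * n))} (hg : g ∈ signedPerm (2 * n))
    {i : Fin n} (h : g (stepLeft i) < g (stepRight i)) :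
    invNum (g * simplePerm i) = invNum g + 2 := by
  set l := stepLeft i with hl
  set r := stepRight i with hr
  have hlr : l < r := stepLeft_lt_stepRight i
  have hsl : simplePerm i l = r := simplePerm_stepLeft i
  have hsr : simplePerm i r = l := simplePerm_stepRight i
  have hg' : g r.rev < g l.rev := by rw [hg, hg, Fin.rev_lt_rev]; exact h
  rw [invNum, ← Equiv.sum_comp ((simplePerm i).prodCongr (simplePerm i))]
  have key : ∀ p : Fin (2 * n) × Fin (2 * n),
      (if simplePerm i p.1 < simplePerm i p.2 ∧ g p.2 < g p.1 then
        (if p.2 = p.1.rev then 2 else 1) else 0) =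
      (if p.1 < p.2 ∧ g p.2 < g p.1 then (if p.2 = p.1.rev then 2 else 1) else 0) +
      if p = (r, l) ∨ p = (l.rev, r.rev) then (if p.2 = p.1.rev then 2 else 1) else 0 := by
    rintro ⟨a, b⟩
    simp only [Prod.mk.injEq]
    by_cases h2 : a = r ∧ b = l
    · obtain ⟨rfl, rfl⟩ := h2
      simp [hsl, hsr, hlr, hlr.not_gt, h]
    by_cases h4 : a = l.rev ∧ b = r.rev
    · obtain ⟨rfl, rfl⟩ := h4
      simp [rev_simplePerm, hsl, hsr, hlr, hlr.not_gt, hg', Fin.rev_lt_rev]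
    rw [if_neg (not_or.2 ⟨h2, h4⟩), add_zero]
    by_cases h1 : a = l ∧ b = r
    · obtain ⟨rfl, rfl⟩ := h1
      simp [h.not_gt]
    by_cases h3 : a = r.rev ∧ b = l.rev
    · obtain ⟨rfl, rfl⟩ := h3
      simp [hg'.not_gt]
    simp only [simplePerm_lt_iff h1 h2 h3 h4]
  have hsum : ∑ p : Fin (2 * n) × Fin (2 * n), (if p = (r, l) ∨ p = (l.rev, r.rev) then
      (if p.2 = p.1.rev then 2 else 1) else 0) = 2 := by
    rw [← sum_filter]
    have hf : ({p | p = (r, l) ∨ p = (l.rev, r.rev)} : Finset (Fin (2 * n) × Fin (2 * n))) =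
        {(r, l), (l.rev, r.rev)} := by ext; simp
    rw [hf]
    -- The two new inversions coincide exactly at the central step, where the weight `2`
    -- compensates.
    by_cases hlr' : l = r.rev
    · rw [hlr', Fin.rev_rev, pair_eq_singleton, sum_singleton, if_pos rfl]
    · have : r ≠ l.rev := fun h => hlr' (by rw [h, Fin.rev_rev])
      rw [sum_pair (by simp [this]), if_neg hlr',
        if_neg (fun h => hlr' (by simpa using h.symm))]
  refine Eq.trans (sum_congr rfl fun p _ => ?_)
    (sum_add_distrib.trans (congrArg (invNum g + ·) hsum))
  rw [← key]
  simp only [Equiv.prodCongr_apply, Prod.map_fst, Prod.map_snd, Equiv.Perm.mul_apply,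
    simplePerm_apply_self, ← rev_simplePerm, (simplePerm i).injective.eq_iff]

theorem invNum_mul_simplePerm_of_gt {g : Equiv.Perm (Fin (2 * n))} (hg : g ∈ signedPerm (2 * n))
    {i : Fin n} (h : g (stepRight i) < g (stepLeft i)) :
    invNum (g * simplePerm i) + 2 = invNum g := by
  rw [← invNum_mul_simplePerm_of_lt (mul_mem hg (simplePerm_mem i)), mul_assoc,
    simplePerm_mul_self, mul_one]
  rwa [Equiv.Perm.mul_apply, Equiv.Perm.mul_apply, simplePerm_stepLeft, simplePerm_stepRight]

theorem lt_or_gt_step (g : Equiv.Perm (Fin (2 * n))) (i : Fin n) :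
    g (stepLeft i) < g (stepRight i) ∨ g (stepRight i) < g (stepLeft i) :=
  lt_or_gt_of_ne (g.injective.ne (stepLeft_lt_stepRight i).ne)

theorem invNum_mul_simplePerm_le {g : Equiv.Perm (Fin (2 * n))} (hg : g ∈ signedPerm (2 * n))
    (i : Fin n) : invNum (g * simplePerm i) ≤ invNum g + 2 := by
  rcases lt_or_gt_step g i with h | h
  · exact (invNum_mul_simplePerm_of_lt hg h).le
  · have := invNum_mul_simplePerm_of_gt hg h
    omega

theorem invNum_one : invNum (1 : Equiv.Perm (Fin (2 * n))) = 0 := by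
  refine sum_eq_zero fun p _ => if_neg ?_
  rintro ⟨h1, h2⟩
  exact h1.not_gt h2

theorem invNum_mul_lt_iff {g : Equiv.Perm (Fin (2 * n))} (hg : g ∈ signedPerm (2 * n))
    {i : Fin n} : invNum (g * simplePerm i) < invNum g ↔ g (stepRight i) < g (stepLeft i) := by
  rcases lt_or_gt_step g i with h | h
  · have := invNum_mul_simplePerm_of_lt hg h
    exact ⟨fun h' => by omega, fun h' => (h.not_gt h').elim⟩
  · have := invNum_mul_simplePerm_of_gt hg h
    exact ⟨fun _ => h, fun _ => by omega⟩

end InvNum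

end SimplePerm

/-! ### Identification of the Coxeter group with the signed permutations -/

section CoxeterIso

variable {n : ℕ} {W : Type*} [Group W] (cs : CoxeterSystem (CoxeterMatrix.B n) W)

theorem simple_comm_of_lt {i j : Fin n} (hij : (i : ℕ) + 1 < j) :
    cs.simple i * cs.simple j = cs.simple j * cs.simple i := by
  have h := cs.simple_mul_simple_pow i j
  have hM : (CoxeterMatrix.B n).M i j = 2 := by
    simp only [CoxeterMatrix.B, Matrix.of_apply]
    rw [if_neg (by rw [Fin.ext_iff]; omega), if_neg (by omega), if_neg (by omega)]
  rw [hM] at h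
  have := eq_inv_of_mul_eq_one_left ((pow_two _).symm.trans h)
  simpa [mul_inv_rev] using this

theorem simple_braid_of_succ {i j : Fin n} (hij : (i : ℕ) + 1 = j) (hj : (j : ℕ) + 1 < n) :
    cs.simple i * cs.simple j * cs.simple i = cs.simple j * cs.simple i * cs.simple j := by
  have h := cs.simple_mul_simple_pow i j
  have hM : (CoxeterMatrix.B n).M i j = 3 := by
    simp only [CoxeterMatrix.B, Matrix.of_apply]
    rw [if_neg (by rw [Fin.ext_iff]; omega), if_neg (by omega), if_pos (by omega)]
  rw [hM] at h
  have h' : (cs.simple i * cs.simple j * cs.simple i) *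
      (cs.simple j * cs.simple i * cs.simple j) = 1 := by
    rw [← h]
    simp only [pow_succ, pow_zero, one_mul, mul_assoc]
  have := eq_inv_of_mul_eq_one_left h'
  simpa [mul_inv_rev, mul_assoc] using this

theorem simple_braid_four_of_succ {i j : Fin n} (hij : (i : ℕ) + 1 = j) (hj : (j : ℕ) + 1 = n) :
    cs.simple i * cs.simple j * cs.simple i * cs.simple j =
      cs.simple j * cs.simple i * cs.simple j * cs.simple i := by
  have h := cs.simple_mul_simple_pow i j
  have hM : (CoxeterMatrix.B n).M i j = 4 := by
    simp only [CoxeterMatrix.B, Matrix.of_apply]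
    rw [if_neg (by rw [Fin.ext_iff]; omega), if_pos (by omega)]
  rw [hM] at h
  have h' : (cs.simple i * cs.simple j * cs.simple i * cs.simple j) *
      (cs.simple i * cs.simple j * cs.simple i * cs.simple j) = 1 := by
    rw [← h]
    simp only [pow_succ, pow_zero, one_mul, mul_assoc]
  have := eq_inv_of_mul_eq_one_left h'
  simpa [mul_inv_rev, mul_assoc] using this

/-- This is local confluence. From `g` with descents `i` and `j`, both alternating paths keep
descending until they meet after `m_{ij}` steps, and the braid relation in `W` equates the
corresponding words. -/
theorem mul_simple_eq_of_lt {ψ : Equiv.Perm (Fin (2 * n)) → W} {g : Equiv.Perm (Fin (2 * n))}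
    (hg : g ∈ signedPerm (2 * n))
    (ih : ∀ g' ∈ signedPerm (2 * n), invNum g' < invNum g → ∀ k,
      g' (stepRight k) < g' (stepLeft k) → ψ g' = ψ (g' * simplePerm k) * cs.simple k)
    {i j : Fin n} (hij : i < j) (hi : g (stepRight i) < g (stepLeft i))
    (hj : g (stepRight j) < g (stepLeft j)) :
    ψ (g * simplePerm i) * cs.simple i = ψ (g * simplePerm j) * cs.simple j := by
  rw [Fin.lt_def] at hij
  have desc : ∀ g' ∈ signedPerm (2 * n), invNum g' ≤ invNum g → ∀ k,
      g' (stepRight k) < g' (stepLeft k) →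
      g' * simplePerm k ∈ signedPerm (2 * n) ∧ invNum (g' * simplePerm k) < invNum g :=
    fun g' hg' hle k hk => ⟨mul_mem hg' (simplePerm_mem k),
      ((invNum_mul_lt_iff hg').2 hk).trans_le hle⟩
  obtain ⟨hi1, hi2⟩ := desc g hg le_rfl i hi
  obtain ⟨hj1, hj2⟩ := desc g hg le_rfl j hj
  have h3 := simplePerm_stepLeft_of_gt hij
  rcases eq_or_lt_of_le (Nat.succ_le_of_lt hij) with h | h
  · have h0 := stepRight_eq_stepLeft h
    have h1 : simplePerm i (stepLeft i) = stepLeft j := by rw [simplePerm_stepLeft, h0]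
    have h2 : simplePerm i (stepLeft j) = stepLeft i := by rw [← h0, simplePerm_stepRight]
    rw [h0] at hi
    have hL := simplePerm_stepLeft j
    have hR := simplePerm_stepRight j
    rcases eq_or_lt_of_le (Nat.succ_le_of_lt j.2) with hj' | hj'
    · have hr := stepRight_eq_rev hj'
      have h4 : simplePerm j (stepLeft j) = (stepLeft j).rev := by rw [hL, hr]
      rw [hr] at hj
      have hda : g (stepLeft i).rev < g (stepLeft j).rev := by
        rw [hg, hg, Fin.rev_lt_rev]; exact hi
      have ei1 : (g * simplePerm i) (stepRight j) < (g * simplePerm i) (stepLeft j) := by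
        simp only [Equiv.Perm.mul_apply, hr, rev_simplePerm, h2]
        exact (hda.trans hj).trans hi
      obtain ⟨hi3, hi4⟩ := desc _ hi1 hi2.le j ei1
      have ei2 : (g * simplePerm i * simplePerm j) (stepRight i) <
          (g * simplePerm i * simplePerm j) (stepLeft i) := by
        simp only [Equiv.Perm.mul_apply, h0, h4, h3, rev_simplePerm, h1, h2]
        exact hda.trans hj
      obtain ⟨hi5, hi6⟩ := desc _ hi3 hi4.le i ei2
      have ei3 : (g * simplePerm i * simplePerm j * simplePerm i) (stepRight j) <
          (g * simplePerm i * simplePerm j * simplePerm i) (stepLeft j) := by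
        simp only [Equiv.Perm.mul_apply, hr, h3, rev_simplePerm, h1, h2]
        exact hj
      have ej1 : (g * simplePerm j) (stepRight i) < (g * simplePerm j) (stepLeft i) := by
        simp only [Equiv.Perm.mul_apply, h0, h4, h3]
        exact hj.trans hi
      obtain ⟨hj3, hj4⟩ := desc _ hj1 hj2.le i ej1
      have ej2 : (g * simplePerm j * simplePerm i) (stepRight j) <
          (g * simplePerm j * simplePerm i) (stepLeft j) := by
        simp only [Equiv.Perm.mul_apply, hr, h3, rev_simplePerm, h2]
        exact (hda.trans hj).trans hi
      obtain ⟨hj5, hj6⟩ := desc _ hj3 hj4.le j ej2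
      have ej3 : (g * simplePerm j * simplePerm i * simplePerm j) (stepRight i) <
          (g * simplePerm j * simplePerm i * simplePerm j) (stepLeft i) := by
        simp only [Equiv.Perm.mul_apply, h0, h4, h3, rev_simplePerm, h1, h2]
        exact hda
      have e := simple_braid_four_of_succ cs h hj'
      have e' := simplePerm_braid_four h hj'
      simp only [mul_assoc] at e e'
      rw [ih _ hi1 hi2 j ei1, ih _ hi3 hi4 i ei2, ih _ hi5 hi6 j ei3,
        ih _ hj1 hj2 i ej1, ih _ hj3 hj4 j ej2, ih _ hj5 hj6 i ej3]
      simp only [mul_assoc, e, e']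
    · have h4 := simplePerm_stepRight_of_succ h hj'
      have ei1 : (g * simplePerm i) (stepRight j) < (g * simplePerm i) (stepLeft j) := by
        simp only [Equiv.Perm.mul_apply, h2, h4]
        exact hj.trans hi
      obtain ⟨hi3, hi4⟩ := desc _ hi1 hi2.le j ei1
      have ei2 : (g * simplePerm i * simplePerm j) (stepRight i) <
          (g * simplePerm i * simplePerm j) (stepLeft i) := by
        simp only [Equiv.Perm.mul_apply, h0, hL, h4, h3, h1]
        exact hj
      have ej1 : (g * simplePerm j) (stepRight i) < (g * simplePerm j) (stepLeft i) := by
        simp only [Equiv.Perm.mul_apply, h0, hL, h3]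
        exact hj.trans hi
      obtain ⟨hj3, hj4⟩ := desc _ hj1 hj2.le i ej1
      have ej2 : (g * simplePerm j * simplePerm i) (stepRight j) <
          (g * simplePerm j * simplePerm i) (stepLeft j) := by
        simp only [Equiv.Perm.mul_apply, hR, h4, h3, h2]
        exact hi
      have e := simple_braid_of_succ cs h hj'
      have e' := simplePerm_braid h hj'
      simp only [mul_assoc] at e e'
      rw [ih _ hi1 hi2 j ei1, ih _ hi3 hi4 i ei2, ih _ hj1 hj2 i ej1, ih _ hj3 hj4 j ej2]
      simp only [mul_assoc, e, e']
  · have ei : (g * simplePerm i) (stepRight j) < (g * simplePerm i) (stepLeft j) := by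
      simp only [Equiv.Perm.mul_apply, simplePerm_stepLeft_of_lt h, simplePerm_stepRight_of_lt h]
      exact hj
    have ej : (g * simplePerm j) (stepRight i) < (g * simplePerm j) (stepLeft i) := by
      simp only [Equiv.Perm.mul_apply, h3, simplePerm_stepRight_of_gt h]
      exact hi
    rw [ih _ hi1 hi2 j ei, ih _ hj1 hj2 i ej]
    simp only [mul_assoc, simple_comm_of_lt cs h, simplePerm_comm h]

open Classical in
/-- The element of `W` obtained by sorting the signed permutation `g`. -/
noncomputable def ofPerm (g : Equiv.Perm (Fin (2 * n))) : W :=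
  if h : ∃ i, invNum (g * simplePerm i) < invNum g then
    ofPerm (g * simplePerm h.choose) * cs.simple h.choose
  else 1
termination_by invNum g
decreasing_by exact h.choose_spec

/-- By confluence the recursive value does not depend on the chosen descent. -/
theorem ofPerm_of_lt (N : ℕ) : ∀ g ∈ signedPerm (2 * n), invNum g = N → ∀ i,
    g (stepRight i) < g (stepLeft i) →
    ofPerm cs g = ofPerm cs (g * simplePerm i) * cs.simple i := by
  induction N using Nat.strong_induction_on with
  | _ N ih =>
  intro g hg hN i hi
  have ih' : ∀ g' ∈ signedPerm (2 * n), invNum g' < invNum g → ∀ k,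
      g' (stepRight k) < g' (stepLeft k) →
      ofPerm cs g' = ofPerm cs (g' * simplePerm k) * cs.simple k :=
    fun g' hg' hlt k hk => ih _ (hN ▸ hlt) g' hg' rfl k hk
  have hex : ∃ i, invNum (g * simplePerm i) < invNum g := ⟨i, (invNum_mul_lt_iff hg).2 hi⟩
  rw [ofPerm, dif_pos hex]
  have hj := (invNum_mul_lt_iff hg).1 hex.choose_spec
  rcases lt_trichotomy i hex.choose with h | h | h
  · exact (mul_simple_eq_of_lt cs hg ih' h hi hj).symm
  · rw [← h]
  · exact mul_simple_eq_of_lt cs hg ih' h hj hi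

theorem ofPerm_mul_simplePerm {g : Equiv.Perm (Fin (2 * n))} (hg : g ∈ signedPerm (2 * n))
    (i : Fin n) : ofPerm cs (g * simplePerm i) = ofPerm cs g * cs.simple i := by
  rcases lt_or_gt_step g i with h | h
  · rw [ofPerm_of_lt cs _ (g * simplePerm i) (mul_mem hg (simplePerm_mem i)) rfl i, mul_assoc,
      simplePerm_mul_self, mul_one]
    rwa [Equiv.Perm.mul_apply, Equiv.Perm.mul_apply, simplePerm_stepLeft, simplePerm_stepRight]
  · rw [ofPerm_of_lt cs _ g hg rfl i h, mul_assoc, cs.simple_mul_simple_self, mul_one]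

theorem ofPerm_one : ofPerm cs 1 = 1 := by
  rw [ofPerm, dif_neg]
  rintro ⟨i, hi⟩
  rw [invNum_one] at hi
  exact hi.not_ge (Nat.zero_le _)

/-- The action of a Coxeter group of type `B` by signed permutations. -/
noncomputable def toPerm : W →* Equiv.Perm (Fin (2 * n)) :=
  cs.lift ⟨simplePerm, isLiftable_simplePerm⟩

theorem toPerm_simple (i : Fin n) : toPerm cs (cs.simple i) = simplePerm i :=
  cs.lift_apply_simple isLiftable_simplePerm i

theorem toPerm_mem (w : W) : toPerm cs w ∈ signedPerm (2 * n) := by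
  induction w using cs.simple_induction_right with
  | one => rw [map_one]; exact one_mem _
  | mul_simple_right w i ih =>
    rw [map_mul, toPerm_simple]
    exact mul_mem ih (simplePerm_mem i)

/-- The sorting construction is a left inverse, so the action by signed permutations is faithful. -/
theorem ofPerm_toPerm (w : W) : ofPerm cs (toPerm cs w) = w := by
  induction w using cs.simple_induction_right with
  | one => rw [map_one, ofPerm_one]
  | mul_simple_right w i ih =>
    rw [map_mul, toPerm_simple, ofPerm_mul_simplePerm cs (toPerm_mem cs w), ih]

theorem toPerm_injective : Function.Injective (toPerm cs) :=
  Function.LeftInverse.injective (ofPerm_toPerm cs)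

/-- Sorting along descents costs two inversions per letter, which gives both surjectivity and the
length bound. -/
theorem exists_toPerm_eq (N : ℕ) : ∀ g ∈ signedPerm (2 * n), invNum g = N →
    ∃ w, toPerm cs w = g ∧ 2 * cs.length w ≤ N := by
  induction N using Nat.strong_induction_on with
  | _ N ih =>
  intro g hg hN
  by_cases h : ∀ i, g (stepLeft i) < g (stepRight i)
  · refine ⟨1, ?_, by simp⟩
    rw [map_one, perm_eq_one_of_strictMono (strictMono_of_forall_steps hg h)]
  · push Not at h
    obtain ⟨i, hi⟩ := h
    have hi' := (lt_or_gt_step g i).resolve_left hi.not_gt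
    have hinv := invNum_mul_simplePerm_of_gt hg hi'
    obtain ⟨w, hw, hl⟩ := ih _ (by omega) _ (mul_mem hg (simplePerm_mem i)) rfl
    refine ⟨w * cs.simple i, ?_, ?_⟩
    · rw [map_mul, toPerm_simple, hw, mul_assoc, simplePerm_mul_self, mul_one]
    · have := cs.length_mul_le w (cs.simple i)
      rw [cs.length_simple] at this
      omega

theorem invNum_toPerm_wordProd_le (ω : List (Fin n)) :
    invNum (toPerm cs (cs.wordProd ω)) ≤ 2 * ω.length := by
  induction ω using List.reverseRecOn with
  | nil => simp [invNum_one]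
  | append_singleton ω i ih =>
    rw [cs.wordProd_append, cs.wordProd_singleton, map_mul, toPerm_simple, List.length_append,
      List.length_singleton]
    have := invNum_mul_simplePerm_le (toPerm_mem cs (cs.wordProd ω)) i
    omega

theorem invNum_toPerm (w : W) : invNum (toPerm cs w) = 2 * cs.length w := by
  apply le_antisymm
  · obtain ⟨ω, hω, rfl⟩ := cs.exists_isReduced w
    rw [hω.eq]
    exact invNum_toPerm_wordProd_le cs ω
  · obtain ⟨w', hw', hl⟩ := exists_toPerm_eq cs _ (toPerm cs w) (toPerm_mem cs w) rfl
    rwa [toPerm_injective cs hw'] at hl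

theorem length_lt_length_mul_simple_iff (w : W) (i : Fin n) :
    cs.length w < cs.length (w * cs.simple i) ↔
      toPerm cs w (stepLeft i) < toPerm cs w (stepRight i) := by
  have h1 := invNum_toPerm cs w
  have h2 := invNum_toPerm cs (w * cs.simple i)
  rw [map_mul, toPerm_simple] at h2
  rcases lt_or_gt_step (toPerm cs w) i with h | h
  · have := invNum_mul_simplePerm_of_lt (toPerm_mem cs w) h
    exact ⟨fun _ => h, fun _ => by omega⟩
  · have := invNum_mul_simplePerm_of_gt (toPerm_mem cs w) h
    exact ⟨fun _ => by omega, fun h' => (h.not_gt h').elim⟩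

end CoxeterIso

/-! ### Transfer to the descent algebra -/

section DescentElement

variable {n : ℕ} {W : Type*} [Group W] (cs : CoxeterSystem (CoxeterMatrix.B n) W)

/-- The embedding of group algebras induced by the action by signed permutations. -/
noncomputable def toPermAlgHom :
    MonoidAlgebra ℚ W →ₐ[ℚ] MonoidAlgebra ℚ (Equiv.Perm (Fin (2 * n))) :=
  MonoidAlgebra.mapDomainAlgHom ℚ ℚ (toPerm cs)

theorem toPermAlgHom_of (w : W) :
    toPermAlgHom cs (MonoidAlgebra.of ℚ W w) = MonoidAlgebra.of ℚ _ (toPerm cs w) := by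
  simp [toPermAlgHom]

theorem toPermAlgHom_injective : Function.Injective (toPermAlgHom cs) :=
  MonoidAlgebra.mapDomain_injective (toPerm_injective cs)

theorem toPermAlgHom_descentElement (J : Finset (Fin n)) :
    toPermAlgHom cs (cs.descentElement J) = ascendingSum J := by
  have : Finite W := Finite.of_injective _ (toPerm_injective cs)
  have hfin := Set.toFinite (cs.distinguishedReps J)
  rw [CoxeterSystem.descentElement, finsum_mem_eq_finite_toFinset_sum _ hfin, map_sum,
    ascendingSum]
  simp only [toPermAlgHom_of]
  refine sum_bij (fun w _ => toPerm cs w) (fun w hw => ?_) (fun _ _ _ _ h => toPerm_injective cs h)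
    (fun g hg => ?_) (fun _ _ => rfl)
  · rw [Set.Finite.mem_toFinset] at hw
    exact mem_ascendingPerms.2 ⟨toPerm_mem cs w, fun i hi =>
      (length_lt_length_mul_simple_iff cs w i).1 (hw i hi)⟩
  · obtain ⟨hg1, hg2⟩ := mem_ascendingPerms.1 hg
    obtain ⟨w, rfl, -⟩ := exists_toPerm_eq cs _ g hg1 rfl
    exact ⟨w, hfin.mem_toFinset.2 fun i hi =>
      (length_lt_length_mul_simple_iff cs w i).2 (hg2 i hi), rfl⟩

theorem mem_span_descentElement {a : MonoidAlgebra ℚ W} {s : Set (Finset (Fin n))}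
    (h : toPermAlgHom cs a ∈ span ℚ (ascendingSum '' s)) :
    a ∈ span ℚ ((fun J : Finset (Fin n) => cs.descentElement J) '' s) := by
  have : ascendingSum '' s = (toPermAlgHom cs).toLinearMap ''
      ((fun J : Finset (Fin n) => cs.descentElement J) '' s) := by
    rw [Set.image_image]
    exact Set.image_congr fun J _ => (toPermAlgHom_descentElement cs J).symm
  rw [this, ← map_span] at h
  obtain ⟨b, hb, hba⟩ := h
  rwa [← toPermAlgHom_injective cs hba]

theorem isTriangularFamily_descentElement :
    IsTriangularFamily fun J : Finset (Fin n) => cs.descentElement J where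
  univ_eq_one := toPermAlgHom_injective cs <| by
    rw [toPermAlgHom_descentElement, ascendingSum_univ, map_one]
  mul_sub_smul_mem I J := by
    obtain ⟨c, hc⟩ := exists_ascendingSum_mul_sub_mem I J
    refine ⟨c, mem_span_descentElement cs ?_⟩
    rwa [map_sub, map_mul, map_smul, toPermAlgHom_descentElement, toPermAlgHom_descentElement]

theorem descentSpace_eq_span :
    cs.descentSpace = span ℚ (Set.range fun J : Finset (Fin n) => cs.descentElement J) := by
  classical
  rw [CoxeterSystem.descentSpace]
  congr 1
  apply Set.Subset.antisymm
  · rintro _ ⟨I, rfl⟩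
    exact ⟨I.toFinset, by simp⟩
  · rintro _ ⟨J, rfl⟩
    exact ⟨J, rfl⟩

theorem exists_toPermAlgHom_eq_of_revPerm :
    ∃ z, toPermAlgHom cs z = MonoidAlgebra.of ℚ _ Fin.revPerm := by
  -- This is the alternating formula for the longest element times `ascendingSum J`, at `J = univ`,
  -- where `ascendingSum J = 1`.
  refine ⟨∑ K : Finset (Fin n), (-1 : ℚ) ^ #K • cs.descentElement K, ?_⟩
  have := of_revPerm_mul_ascendingSum (univ : Finset (Fin n))
  rw [ascendingSum_univ, mul_one, powerset_univ] at this
  simp only [map_sum, map_smul, toPermAlgHom_descentElement, this]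

theorem isLoewyLength_descentAlgebra {m : ℕ} (hm : 2 * m < n) (hmn : n ≤ 2 * (m + 1)) :
    IsLoewyLength (isTriangularFamily_descentElement cs).subalgebra (m + 1) := by
  have hinj := toPermAlgHom_injective cs
  have he := toPermAlgHom_descentElement cs
  obtain ⟨z, hz⟩ := exists_toPermAlgHom_eq_of_revPerm cs
  refine (isTriangularFamily_descentElement cs).isLoewyLength (z := z) ?_ (fun J => ?_)
    (fun J => hinj ?_) (hinj ?_) (by simpa using hmn) {i | (i : ℕ) ≠ 0} {i | (i : ℕ) + 1 ≠ n}
    (fun h => ?_)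
  · obtain ⟨c, hc, h⟩ := ascendingSum_empty_mul_self (n := n)
    refine ⟨c, hc, hinj ?_⟩
    rwa [map_mul, map_smul, he]
  · apply mem_span_descentElement
    rw [map_sub, map_mul, map_smul, he, hz]
    exact of_revPerm_mul_sub_mem J
  · rw [map_mul, map_mul, he, hz, of_revPerm_mul_comm]
  · rw [map_mul, hz, of_revPerm_mul_self, map_one]
  · apply ascendingCommutator_pow_ne_zero hm
    rw [← map_zero (toPermAlgHom cs), ← h, map_pow, map_sub, map_mul, map_mul, he, he,
      ascendingCommutator]

end DescentElement

end

/-- For a Coxeter system `(W, S)` of type `B_n`, `n ≥ 1`, the group `W` is finite, the span `Σ(W)`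
of the elements `x_I`, `I ⊆ S`, is a unital subalgebra of `ℚ W` (the descent algebra), and the
Loewy length of this algebra is `⌈n / 2⌉`. -/
theorem mainTheorem3 (n : ℕ) (hn : 1 ≤ n) {W : Type*} [Group W]
    (cs : CoxeterSystem (CoxeterMatrix.B n) W) :
    Finite W ∧
      ∃ A : Subalgebra ℚ (MonoidAlgebra ℚ W),
        Subalgebra.toSubmodule A = cs.descentSpace ∧
        IsLoewyLength A ⌈(n : ℚ) / 2⌉₊ := by
  refine ⟨Finite.of_injective _ (toPerm_injective cs),
    (isTriangularFamily_descentElement cs).subalgebra,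
    (isTriangularFamily_descentElement cs).toSubmodule_subalgebra.trans
      (descentSpace_eq_span cs).symm, ?_⟩
  -- Here `m = (n - 1) / 2`, rounded down, is the unique number with `2 * m < n ≤ 2 * (m + 1)`.
  have h : ⌈(n : ℚ) / 2⌉₊ = (n - 1) / 2 + 1 := by
    rw [Nat.ceil_eq_iff (by omega), Nat.add_sub_cancel, lt_div_iff₀ two_pos, div_le_iff₀ two_pos]
    norm_cast
    omega
  rw [h]
  exact isLoewyLength_descentAlgebra cs (by omega) (by omega)
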